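/- Let $C$ be a finite set of candidates. A weak order on $C$ is a transitive relation $\succsim$ on $C$ such that $a\succsim b$ or $b\succsim a$ for all $a,b\in C$; write $a>b$ if $a\succsim b$ and not $b\succsim a$. A profile is a finite multiset $V$ of weak orders on $C$. It is called single-plateaued if there is a total order $A$ on $C$ (an axis) such that for every $v\in V$ the axis can be split into three consecutive segments $X,Y,Z$ (in this order along $A$; $X$ and $Z$ may be empty), where $Y$ is the set of the most preferred candidates of $v$, $v$ is strictly increasing along $X$ (if $a,b\in X$ and $a$ precedes $b$ on $A$, then $b>a$ in $v$), and $v$ is strictly decreasing along $Z$ (if $a,b\in Z$ and $a$ precedes $b$ on $A$, then $a>b$ in $v$). Theorem. The problem of determining whether a given profile of weak orders is single-plateaued is in $\mathrm{P}$. Precisely: encode a profile $(v_1,\dots,v_n)$ on the candidates $0,\dots,m-1$ as the string that consists of $m$ in unary, followed for each $i=1,\dots,n$ by a comma and by the $m^2$ bits, row by row, of the relation $\succsim$ of $v_i$. Then the language of the codes of all single-plateaued profiles is decided by a deterministic (multi-stack) Turing machine whose running time is bounded by a polynomial in the length of the input string. -/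

import Mathlib

namespace SinglePlateaued

/-- A weak order on `C` (a total preorder): `v.pref a b` says that `a` is ranked at least
as high as `b`. -/
structure WeakOrder (C : Type*) where
  /-- the relation "at least as good as" -/
  pref : C → C → Prop
  trans : ∀ a b c, pref a b → pref b c → pref a c
  total : ∀ a b, pref a b ∨ pref b a

namespace WeakOrder

variable {C : Type*}

/-- Strict preference: `a` is ranked strictly above `b`. -/
def strict (v : WeakOrder C) (a b : C) : Prop :=
  v.pref a b ∧ ¬ v.pref b a

/-- The set of the most preferred candidates. -/
def top (v : WeakOrder C) : Set C :=
  {c | ∀ d, v.pref c d}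

/-- `v` is single-plateaued with respect to the axis `A`: the axis is split into consecutive
segments `X`, `Y`, `Z`, in this order, such that `Y` consists of the most preferred candidates,
`v` strictly increases along `X` and strictly decreases along `Z`.  The segments `X` and `Z`
may be empty. -/
def IsSinglePlateauedOn (v : WeakOrder C) (A : LinearOrder C) : Prop :=
  ∃ X Y Z : Set C,
    X ∪ Y ∪ Z = Set.univ ∧
    (∀ x ∈ X, ∀ y ∈ Y, A.lt x y) ∧
    (∀ y ∈ Y, ∀ z ∈ Z, A.lt y z) ∧
    (∀ x ∈ X, ∀ z ∈ Z, A.lt x z) ∧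
    Y = v.top ∧
    (∀ a ∈ X, ∀ b ∈ X, A.lt a b → v.strict b a) ∧
    (∀ a ∈ Z, ∀ b ∈ Z, A.lt a b → v.strict a b)

end WeakOrder

/-- A profile (a multiset of weak orders) is single-plateaued if all its members are so with
respect to one common axis. -/
def IsSinglePlateaued {C : Type*} (V : Multiset (WeakOrder C)) : Prop :=
  ∃ A : LinearOrder C, ∀ v ∈ V, v.IsSinglePlateauedOn A

open Computability

open Classical in
/-- A weak order on `m` candidates, written as the `m * m` bits of its relation, row by row. -/
noncomputable def encodeOrder {m : ℕ} (v : WeakOrder (Fin m)) : List Γ' :=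
  (List.finRange m).flatMap fun a =>
    (List.finRange m).map fun b => Γ'.bit (decide (v.pref a b))

/-- A profile over the candidates `0, …, m - 1`, its members listed in some order: the number of
candidates in unary, and then every member, preceded by a comma. -/
noncomputable def encodeProfile {m : ℕ} (V : List (WeakOrder (Fin m))) : List Γ' :=
  List.replicate m (Γ'.bit true) ++ V.flatMap fun v => Γ'.comma :: encodeOrder v

/-- The decision problem "is the given profile of weak orders single-plateaued?" as a language:
the codes of the single-plateaued profiles.  (`encodeProfile_injective` below: a string is the
code of at most one list of weak orders.) -/
def singlePlateauedLanguage : Language Γ' :=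
  {w | ∃ (m : ℕ) (V : List (WeakOrder (Fin m))),
    w = encodeProfile V ∧ IsSinglePlateaued (V : Multiset (WeakOrder (Fin m)))}

/-- The class P: the languages that are decided by a deterministic multi-stack Turing machine
within a number of steps that is polynomial in the length of the input string.  Every string over
the alphabet is an input, and the machine answers with one bit. -/
def InP {Γ : Type} (L : Language Γ) : Prop :=
  ∃ f : List Γ → Bool, (∀ w, f w = true ↔ w ∈ L) ∧
    Nonempty (Turing.TM2ComputableInPolyTime (id : List Γ → List Γ) encodeBool f)

theorem length_encodeOrder {m : ℕ} (v : WeakOrder (Fin m)) :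
    (encodeOrder v).length = m * m := by
  simp [encodeOrder, List.length_flatMap]

theorem flatMap_inj {α β : Type*} (f g : α → List β) (hl : ∀ a, (f a).length = (g a).length) :
    ∀ l : List α, l.flatMap f = l.flatMap g → ∀ a ∈ l, f a = g a := by
  intro l
  induction l with
  | nil => intro _ a ha; simp at ha
  | cons x l ih =>
    intro h a ha
    simp only [List.flatMap_cons] at h
    obtain ⟨h1, h2⟩ := List.append_inj h (hl x)
    rcases List.mem_cons.1 ha with rfl | ha
    · exact h1
    · exact ih h2 a ha

theorem encodeOrder_injective {m : ℕ} :
    Function.Injective (encodeOrder : WeakOrder (Fin m) → List Γ') := by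
  intro v w h
  have h1 := flatMap_inj _ _ (by intro a; simp) _ h
  have h2 : v.pref = w.pref := by
    funext a b
    have h3 := h1 a (List.mem_finRange a)
    have h4 := (List.map_inj_left.1 h3) b (List.mem_finRange b)
    simpa using h4
  cases v; cases w; cases h2; rfl

/-- A code determines the number of candidates and the list of weak orders. -/
theorem encodeProfile_injective :
    Function.Injective
      (fun p : (Σ m : ℕ, List (WeakOrder (Fin m))) => encodeProfile p.2) := by
  have key : ∀ {m : ℕ} (V : List (WeakOrder (Fin m))),
      ((encodeProfile V).takeWhile fun c => decide (c ≠ Γ'.comma)).length = m := by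
    intro m V
    rw [encodeProfile, List.takeWhile_append_of_pos (by
      intro c hc; rw [List.eq_of_mem_replicate hc]; simp)]
    cases V <;> simp
  rintro ⟨m, V⟩ ⟨m', W⟩ h
  simp only at h
  have hm : m = m' := by rw [← key V, h, key W]
  subst hm
  have h' := List.append_cancel_left h
  have hVW : V = W := by
    clear h
    induction V generalizing W with
    | nil => cases W with
      | nil => rfl
      | cons w W => simp at h'
    | cons v V ih => cases W with
      | nil => simp at h'
      | cons w W =>
        simp only [List.flatMap_cons, List.cons_append, List.cons.injEq, true_and] at h'
        obtain ⟨h1, h2⟩ := List.append_inj h'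
          ((length_encodeOrder v).trans (length_encodeOrder w).symm)
        rw [encodeOrder_injective h1, ih W h2]
  rw [hVW]

end SinglePlateaued

/-! The combinatorial core is a statement about a single vote. If `d` is not a most preferred
candidate of `v`, and `e`, `c` are different from `d` and at least as good as `d`, then `d` cannot
lie between `e` and `c` on an axis for `v`: from a point of the increasing segment everything at
least as good lies to the right, from a point of the decreasing segment to the left. So the ordered
pairs `(e, d)` and `(c, d)` have the same orientation on every axis, and so do `(d, e)` and `(d,
c)`. These links generate an equivalence relation on ordered pairs, and a profile with a pair
equivalent to its reverse has no axis.

This obstruction is the only one (`isSinglePlateaued_iff`). Without it, every pair can be oriented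
consistently with the links by comparing the class of `(a, b)` with that of `(b, a)`. Transitivity
comes almost for free. If some vote does not have all of `a`, `b`, `c` on its plateau, then a worst
one of the three for this vote is not top, hence is not between the other two, and the three cannot
form a cycle. Two candidates that are top in every vote occur together in no link, so such pairs may
be oriented by an arbitrary linear order. The resulting order is an axis
(`isSinglePlateaued_of_orientation`).

Deciding single-plateauedness is thus a reachability problem on pairs of candidates, after a
syntactic check of the code. For the Turing machine bound, structured stack programs (`Cmd`) are
compiled to machines with an exact step count (`Exec.stepsTo`). On top of them, formulas with
quantifiers bounded by the length of the word (`Fm`) and programs that only mark memory cells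
(`Prog`) are shown to run in polynomial time (`Fm.exists_spec`, `Prog.exists_spec`, `inP_of_prog`).
With `n` the length of the input plus one, a memory of `n ^ 4` cells records which pair is reachable
from which. Since marks are never erased, `n ^ 4` rounds reach a fixed point, which is exactly
reachability (`reachProg_sound`, `reachProg_complete`). -/

namespace SinglePlateaued

open Computability Turing Function

/-! ### A structured language for machines with several stacks -/

/-- Structured programs over a family of stacks. -/
inductive Cmd (K : Type) : Type
  | skip : Cmd K
  | push : K → Γ' → Cmd K
  | pop : K → Cmd K
  | move : K → K → Cmd K
  | seq : Cmd K → Cmd K → Cmd K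
  | ite : K → (Option Γ' → Bool) → Cmd K → Cmd K → Cmd K
  | loopWhile : K → (Option Γ' → Bool) → Cmd K → Cmd K

namespace Cmd

variable {K : Type}

/-- The control points of a program. -/
def Label : Cmd K → Type
  | skip => Empty
  | push _ _ => Unit
  | pop _ => Unit
  | move _ _ => Unit
  | seq c d => c.Label ⊕ d.Label
  | ite _ _ c d => Option (c.Label ⊕ d.Label)
  | loopWhile _ _ c => Option c.Label

instance instFintypeLabel : (c : Cmd K) → Fintype c.Label
  | skip => inferInstanceAs (Fintype Empty)
  | push _ _ => inferInstanceAs (Fintype Unit)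
  | pop _ => inferInstanceAs (Fintype Unit)
  | move _ _ => inferInstanceAs (Fintype Unit)
  | seq c d =>
    haveI := instFintypeLabel c
    haveI := instFintypeLabel d
    inferInstanceAs (Fintype (c.Label ⊕ d.Label))
  | ite _ _ c d =>
    haveI := instFintypeLabel c
    haveI := instFintypeLabel d
    inferInstanceAs (Fintype (Option (c.Label ⊕ d.Label)))
  | loopWhile _ _ c =>
    haveI := instFintypeLabel c
    inferInstanceAs (Fintype (Option c.Label))

/-- The stack alphabets of the compiled machine: all stacks hold symbols of `Γ'`, except for an
additional output stack `none`, which holds bits. -/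
abbrev Alphabet (K : Type) : Option K → Type
  | none => Bool
  | some _ => Γ'

/-- The statements of the compiled machine. -/
abbrev MachineStmt (K Λ : Type) := TM2.Stmt (Alphabet K) Λ (Option Γ')

/-- Branch to one of two labels according to the top of a stack. -/
def testStmt {Λ : Type} (k : K) (P : Option Γ' → Bool) (q r : Λ) : MachineStmt K Λ :=
  .peek (some k) (fun _ o => o)
    (.branch P (.load (fun _ => none) (.goto fun _ => q))
      (.load (fun _ => none) (.goto fun _ => r)))

/-- Move the top of one stack to another one. -/
def moveStmt {Λ : Type} (k l : K) (q : Λ) : MachineStmt K Λ :=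
  .pop (some k) (fun _ o => o)
    (.branch Option.isSome
      (.push (some l) (fun o : Option Γ' => o.getD Γ'.blank)
        (.load (fun _ => none) (.goto fun _ => q)))
      (.load (fun _ => none) (.goto fun _ => q)))

/-- The label at which the execution of a program starts, for an embedding of its control points
into a larger set of labels, and an exit label. -/
def entry {Λ : Type} : (c : Cmd K) → (c.Label → Λ) → Λ → Λ
  | skip, _, e => e
  | push _ _, emb, _ => emb ()
  | pop _, emb, _ => emb ()
  | move _ _, emb, _ => emb ()
  | seq c d, emb, e => c.entry (fun q => emb (.inl q)) (d.entry (fun q => emb (.inr q)) e)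
  | ite _ _ _ _, emb, _ => emb none
  | loopWhile _ _ _, emb, _ => emb none

/-- The statements at the control points of a program. -/
def code {Λ : Type} : (c : Cmd K) → (c.Label → Λ) → Λ → c.Label → MachineStmt K Λ
  | skip, _, _, q => nomatch q
  | push k a, _, e, _ => .push (some k) (fun _ => a) (.goto fun _ => e)
  | pop k, _, e, _ => .pop (some k) (fun s _ => s) (.goto fun _ => e)
  | move k l, _, e, _ => moveStmt k l e
  | seq c d, emb, e, .inl q =>
    c.code (fun q => emb (.inl q)) (d.entry (fun q => emb (.inr q)) e) q
  | seq _ d, emb, e, .inr q => d.code (fun q => emb (.inr q)) e q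
  | ite k P c d, emb, e, none =>
    testStmt k P (c.entry (fun q => emb (some (.inl q))) e)
      (d.entry (fun q => emb (some (.inr q))) e)
  | ite _ _ c _, emb, e, some (.inl q) => c.code (fun q => emb (some (.inl q))) e q
  | ite _ _ _ d, emb, e, some (.inr q) => d.code (fun q => emb (some (.inr q))) e q
  | loopWhile k P c, emb, e, none => testStmt k P (c.entry (fun q => emb (some q)) (emb none)) e
  | loopWhile _ _ c, emb, _, some q => c.code (fun q => emb (some q)) (emb none) q

variable [DecidableEq K]

/-- The effect of moving the top of the stack `k` to the stack `l`. -/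
def moved (k l : K) (s : K → List Γ') : K → List Γ' :=
  match s k with
  | [] => s
  | a :: r => update (update s k r) l (a :: update s k r l)

/-- `Exec c s s' t`: the program `c` leads from the stack contents `s` to `s'` in `t` steps. -/
inductive Exec : Cmd K → (K → List Γ') → (K → List Γ') → ℕ → Prop
  | skip (s) : Exec skip s s 0
  | push (k a s) : Exec (push k a) s (update s k (a :: s k)) 1
  | pop (k s) : Exec (pop k) s (update s k (s k).tail) 1
  | move (k l s) : Exec (move k l) s (moved k l s) 1
  | seq {c d s s' s'' t t'} : Exec c s s' t → Exec d s' s'' t' → Exec (seq c d) s s'' (t + t')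
  | ite_true {k P c d s s' t} :
    P (s k).head? = true → Exec c s s' t → Exec (ite k P c d) s s' (1 + t)
  | ite_false {k P c d s s' t} :
    P (s k).head? = false → Exec d s s' t → Exec (ite k P c d) s s' (1 + t)
  | while_true {k P c s s' s'' t t'} : P (s k).head? = true → Exec c s s' t →
    Exec (loopWhile k P c) s' s'' t' → Exec (loopWhile k P c) s s'' (1 + (t + t'))
  | while_false {k P c s} : P (s k).head? = false → Exec (loopWhile k P c) s s 1

/-- The stack contents of the compiled machine; the output stack is empty. -/
def fullStack (s : K → List Γ') : ∀ k : Option K, List (Alphabet K k)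
  | none => []
  | some k => s k

theorem update_fullStack (s : K → List Γ') (k : K) (l : List Γ') :
    update (fullStack s) (some k) l = fullStack (update s k l) := by
  funext k'
  rcases k' with _ | k'
  · rw [update_of_ne (by simp)]; rfl
  · by_cases h : k' = k
    · subst h; rw [update_self]; simp [fullStack]
    · rw [update_of_ne (by simpa using h)]; simp [fullStack, h]

/-- A number of steps of a machine. -/
def StepsTo {Λ : Type} (M : Λ → MachineStmt K Λ) (n : ℕ)
    (x y : TM2.Cfg (Alphabet K) Λ (Option Γ')) : Prop :=
  (flip bind (TM2.step M))^[n] (some x) = some y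

theorem StepsTo.trans {Λ : Type} {M : Λ → MachineStmt K Λ} {n n' : ℕ}
    {x y z : TM2.Cfg (Alphabet K) Λ (Option Γ')} (h : StepsTo M n x y) (h' : StepsTo M n' y z) :
    StepsTo M (n + n') x z := by
  unfold StepsTo at *
  rw [add_comm, iterate_add_apply, h, h']

theorem StepsTo.one {Λ : Type} {M : Λ → MachineStmt K Λ} {q : Λ} {v : Option Γ'}
    {S : ∀ k, List (Alphabet K k)} {y : TM2.Cfg (Alphabet K) Λ (Option Γ')}
    (h : TM2.stepAux (M q) v S = y) : StepsTo M 1 ⟨some q, v, S⟩ y := by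
  simp [StepsTo, flip, h]

/-- Tests and moves reset the internal register to `none` before they jump, and the other statements
leave it alone. Between control points a configuration is therefore given by the label and the
stacks, which is why simulation statements mention only the register value `none`. -/
theorem stepAux_testStmt {Λ : Type} (k : K) (P : Option Γ' → Bool) (q r : Λ) (s : K → List Γ') :
    TM2.stepAux (testStmt k P q r) none (fullStack s) =
      ⟨some (if P (s k).head? then q else r), none, fullStack s⟩ := by
  simp only [testStmt, TM2.stepAux]
  have : P (fullStack s (some k)).head? = P (s k).head? := rfl
  rw [this]
  cases P (s k).head? <;> rfl

theorem stepAux_moveStmt {Λ : Type} (k l : K) (q : Λ) (s : K → List Γ') :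
    TM2.stepAux (moveStmt k l q) none (fullStack s) =
      ⟨some q, none, fullStack (moved k l s)⟩ := by
  simp only [moveStmt, TM2.stepAux, moved]
  have h : fullStack s (some k) = s k := rfl
  rw [h]
  rw [update_fullStack]
  cases hk : s k with
  | nil =>
    simp only [List.head?_nil, Option.isSome_none, cond_false, List.tail_nil]
    rw [← hk, update_eq_self]
  | cons a r =>
    simp only [List.head?_cons, Option.isSome_some, cond_true, Option.getD_some, List.tail_cons]
    rw [update_fullStack]
    rfl

/-- The compiled code follows the execution of the program. -/
theorem Exec.stepsTo {Λ : Type} {M : Λ → MachineStmt K Λ} {c : Cmd K} {s s' : K → List Γ'} {t : ℕ}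
    (h : Exec c s s' t) : ∀ (emb : c.Label → Λ) (e : Λ), (∀ q, M (emb q) = c.code emb e q) →
      StepsTo M t ⟨some (c.entry emb e), none, fullStack s⟩ ⟨some e, none, fullStack s'⟩ := by
  induction h with
  | skip s => intro emb e _; rfl
  | push k a s =>
    intro emb e h
    refine StepsTo.one ?_
    erw [h ()]
    simp only [code, TM2.stepAux]
    erw [update_fullStack]
    rfl
  | pop k s =>
    intro emb e h
    refine StepsTo.one ?_
    erw [h ()]
    simp only [code, TM2.stepAux]
    erw [update_fullStack]
    rfl
  | move k l s =>
    intro emb e h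
    refine StepsTo.one ?_
    erw [h ()]
    exact stepAux_moveStmt k l e s
  | seq _ _ ih ih' =>
    intro emb e h
    exact (ih _ _ fun q => h (.inl q)).trans (ih' _ _ fun q => h (.inr q))
  | ite_true hP _ ih =>
    intro emb e h
    refine (StepsTo.one ?_).trans (ih (fun q => emb (some (.inl q))) e fun q => h (some (.inl q)))
    erw [h none]
    simp only [code]
    rw [stepAux_testStmt, if_pos hP]
  | ite_false hP _ ih =>
    intro emb e h
    refine (StepsTo.one ?_).trans (ih (fun q => emb (some (.inr q))) e fun q => h (some (.inr q)))
    erw [h none]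
    simp only [code]
    rw [stepAux_testStmt, if_neg (by simp [hP])]
  | while_true hP _ _ ih ih' =>
    intro emb e h
    refine (StepsTo.one ?_).trans
      ((ih (fun q => emb (some q)) (emb none) fun q => h (some q)).trans (ih' emb e h))
    erw [h none]
    simp only [code]
    rw [stepAux_testStmt, if_pos hP]
  | while_false hP =>
    intro emb e h
    refine StepsTo.one ?_
    erw [h none]
    simp only [code]
    rw [stepAux_testStmt, if_neg (by simp [hP])]

/-- Output the bit on top of the stack `k`, and halt. -/
def outputStmt {Λ : Type} (k : K) : MachineStmt K Λ :=
  .pop (some k) (fun _ o => o)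
    (.push none (fun o : Option Γ' => (decide (o = some (Γ'.bit true)) : Bool))
      (.load (fun _ => none) .halt))

/-- The machine that runs a program on the input stack `i`, and then outputs the bit on top of the
stack `o`. -/
def machine [Fintype K] (c : Cmd K) (i o : K) : FinTM2 where
  K := Option K
  k₀ := some i
  k₁ := none
  Γ := Alphabet K
  Λ := Option c.Label
  main := c.entry some none
  σ := Option Γ'
  initialState := none
  Γk₀Fin := inferInstanceAs (Fintype Γ')
  m
    | none => outputStmt o
    | some q => c.code some none q

/-- A language is in P if a structured program decides it in polynomial time and leaves only the
answer, on the stack `o`. -/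
theorem inP_of_exec [Fintype K] {L : Language Γ'} (f : List Γ' → Bool)
    (hf : ∀ w, f w = true ↔ w ∈ L) (c : Cmd K) (i o : K) (p : Polynomial ℕ)
    (h : ∀ w, ∃ t ≤ p.eval w.length,
      Exec c (update (fun _ => []) i w) (update (fun _ => []) o [Γ'.bit (f w)]) t) : InP L := by
  refine ⟨f, hf, ⟨{
    tm := machine c i o
    inputAlphabet := Equiv.refl _
    outputAlphabet := Equiv.refl _
    -- The extra step is `outputStmt`, which transfers the answer to the output stack and halts.
    time := p + 1
    outputsFun := fun w => Classical.choice ?_ }⟩⟩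
  obtain ⟨t, ht, he⟩ := h w
  have h1 := he.stepsTo (M := (machine c i o).m) some none fun q => rfl
  have h2 : StepsTo (machine c i o).m 1
      ⟨some none, none, fullStack (update (fun _ => []) o [Γ'.bit (f w)])⟩
      (haltList (machine c i o) [f w]) := by
    refine StepsTo.one ?_
    change TM2.stepAux (outputStmt o) _ _ = _
    simp only [outputStmt, TM2.stepAux]
    rw [update_fullStack]
    simp only [haltList]
    congr 1
    funext k
    rcases k with _ | k
    · rw [update_self]
      simp only [machine]
      have h3 : fullStack (update (fun _ => []) o [Γ'.bit (f w)]) (some o) = [Γ'.bit (f w)] := by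
        simp [fullStack]
      rw [h3]
      cases f w <;> rfl
    · rw [update_of_ne (by simp)]
      simp only [machine]
      by_cases hk : k = o
      · subst hk
        simp [fullStack]
      · simp [fullStack, hk]
  have h0 : initList (machine c i o) w =
      ⟨some (c.entry some none), none, fullStack (update (fun _ => []) i w)⟩ := by
    simp only [initList]
    congr 1
    funext k
    rcases k with _ | k
    · simp [machine, fullStack]
    · by_cases hk : k = i
      · subst hk
        simp [machine, fullStack]
        rfl
      · simp [machine, fullStack, hk]
  refine ⟨⟨⟨t + 1, ?_⟩, ?_⟩⟩
  · have h3 := h1.trans h2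
    have h4 : List.map (Equiv.refl Γ').invFun (id w) = w := by simp
    have h5 : List.map (Equiv.refl Bool).invFun (encodeBool (f w)) = [f w] := by
      simp [encodeBool, pure]
    erw [h4, h5, h0]
    exact h3
  · simpa using ht

end Cmd

end SinglePlateaued

/-! ### Time-bounded execution and counted loops with a control stack. -/

namespace SinglePlateaued

open Computability Turing Function

namespace Cmd

section Bounded

variable {K : Type} [DecidableEq K]

/-- Execution within a given number of steps. -/
def ExecIn (c : Cmd K) (s s' : K → List Γ') (τ : ℕ) : Prop :=
  ∃ t ≤ τ, Exec c s s' t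

theorem Exec.execIn {c : Cmd K} {s s' : K → List Γ'} {t : ℕ} (h : Exec c s s' t) :
    ExecIn c s s' t :=
  ⟨t, le_rfl, h⟩

theorem ExecIn.mono {c : Cmd K} {s s' : K → List Γ'} {τ τ' : ℕ} (h : ExecIn c s s' τ)
    (hτ : τ ≤ τ') : ExecIn c s s' τ' :=
  let ⟨t, ht, he⟩ := h
  ⟨t, ht.trans hτ, he⟩

theorem ExecIn.seq {c d : Cmd K} {s s' s'' : K → List Γ'} {τ τ' : ℕ} (h : ExecIn c s s' τ)
    (h' : ExecIn d s' s'' τ') : ExecIn (seq c d) s s'' (τ + τ') :=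
  let ⟨_, ht, he⟩ := h
  let ⟨_, ht', he'⟩ := h'
  ⟨_, Nat.add_le_add ht ht', he.seq he'⟩

theorem ExecIn.while_step {k : K} {P : Option Γ' → Bool} {c : Cmd K} {s s' s'' : K → List Γ'}
    {τ τ' : ℕ} (hP : P (s k).head? = true) (h : ExecIn c s s' τ)
    (h' : ExecIn (loopWhile k P c) s' s'' τ') : ExecIn (loopWhile k P c) s s'' (1 + (τ + τ')) :=
  let ⟨_, ht, he⟩ := h
  let ⟨_, ht', he'⟩ := h'
  ⟨_, Nat.add_le_add le_rfl (Nat.add_le_add ht ht'), Exec.while_true hP he he'⟩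

end Bounded

/-- The stack contents `s`, together with a control stack `C`. -/
def withControl {K : Type} (s : K → List Γ') (C : List Γ') : Option K → List Γ'
  | none => C
  | some k => s k

@[simp]
theorem withControl_none {K : Type} (s : K → List Γ') (C : List Γ') :
    withControl s C none = C := rfl

@[simp]
theorem withControl_some {K : Type} (s : K → List Γ') (C : List Γ') (k : K) :
    withControl s C (some k) = s k := rfl

variable {K : Type} [DecidableEq K]

@[simp]
theorem update_withControl_some (s : K → List Γ') (C : List Γ') (k : K) (l : List Γ') :
    update (withControl s C) (some k) l = withControl (update s k l) C := by
  funext k'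
  rcases k' with _ | k'
  · rw [update_of_ne (by simp)]; rfl
  · by_cases h : k' = k
    · subst h; simp
    · rw [update_of_ne (by simpa using h)]; simp [h]

@[simp]
theorem update_withControl_none (s : K → List Γ') (C l : List Γ') :
    update (withControl s C) none l = withControl s l := by
  funext k'
  rcases k' with _ | k'
  · rw [update_self]; rfl
  · rw [update_of_ne (by simp)]; rfl

/-- The program `c` leads from `s` to `s'` in at most `τ` steps, whatever is on the control stack,
which is left as it was. -/
def Spec (c : Cmd (Option K)) (s s' : K → List Γ') (τ : ℕ) : Prop :=
  ∀ C, ExecIn c (withControl s C) (withControl s' C) τ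

namespace Spec

variable {c d : Cmd (Option K)} {s s' s'' : K → List Γ'} {τ τ' : ℕ}

theorem mono (h : Spec c s s' τ) (hτ : τ ≤ τ') : Spec c s s' τ' := fun C => (h C).mono hτ

theorem congr_right (h : Spec c s s' τ) (hs : s' = s'') : Spec c s s'' τ := hs ▸ h

theorem congr_left (h : Spec c s s' τ) (hs : s = s'') : Spec c s'' s' τ := hs ▸ h

theorem skip (s : K → List Γ') : Spec skip s s 0 := fun _ => (Exec.skip _).execIn

theorem seq (h : Spec c s s' τ) (h' : Spec d s' s'' τ') : Spec (seq c d) s s'' (τ + τ') :=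
  fun C => (h C).seq (h' C)

theorem push (k : K) (a : Γ') (s : K → List Γ') :
    Spec (push (some k) a) s (update s k (a :: s k)) 1 := fun C => by
  have := (Exec.push (some k) a (withControl s C)).execIn
  simpa using this

theorem pop (k : K) (s : K → List Γ') : Spec (pop (some k)) s (update s k (s k).tail) 1 :=
  fun C => by
  have := (Exec.pop (some k) (withControl s C)).execIn
  simpa using this

theorem move_nil {k : K} (l : K) {s : K → List Γ'} (h : s k = []) :
    Spec (move (some k) (some l)) s s 1 := fun C => by
  have := (Exec.move (some k) (some l) (withControl s C)).execIn
  simpa [moved, h] using this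

theorem move_cons {k l : K} (hkl : k ≠ l) {s : K → List Γ'} {a : Γ'} {r : List Γ'}
    (h : s k = a :: r) :
    Spec (move (some k) (some l)) s (update (update s k r) l (a :: s l)) 1 := fun C => by
  have := (Exec.move (some k) (some l) (withControl s C)).execIn
  simpa [moved, h, hkl.symm] using this

theorem ite (k : K) {P : Option Γ' → Bool} (h : P (s k).head? = true → Spec c s s' τ)
    (h' : P (s k).head? = false → Spec d s s' τ) :
    Spec (ite (some k) P c d) s s' (1 + τ) := fun C => by
  cases hP : P (s k).head? with
  | true =>
    obtain ⟨t, ht, he⟩ := h hP C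
    exact ⟨1 + t, by omega, Exec.ite_true (by simpa using hP) he⟩
  | false =>
    obtain ⟨t, ht, he⟩ := h' hP C
    exact ⟨1 + t, by omega, Exec.ite_false (by simpa using hP) he⟩

end Spec

/-- Move everything from the stack `k` to the stack `l`. -/
def moveAll (k l : K) : Cmd (Option K) :=
  loopWhile (some k) Option.isSome (move (some k) (some l))

/-- Empty the stack `k`. -/
def clear (k : K) : Cmd (Option K) :=
  loopWhile (some k) Option.isSome (pop (some k))

/-- The symbol that unary numbers consist of. -/
abbrev one : Γ' := Γ'.bit true

/-- Empty the stack `k`, and push its length in unary on the control stack. -/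
def unload (k : K) : Cmd (Option K) :=
  loopWhile (some k) Option.isSome (seq (pop (some k)) (push none one))

/-- Perform `c` as often as the unary number on the control stack says, and remove that number,
which has to be followed by a comma. -/
def repeatControl (c : Cmd (Option K)) : Cmd (Option K) :=
  seq (loopWhile none (fun o => decide (o = some one)) (seq (pop none) c)) (pop none)

/-- Each symbol costs a test and a move; one failing test ends the loop. -/
theorem Spec.moveAll {k l : K} (hkl : k ≠ l) (s : K → List Γ') :
    Spec (moveAll k l) s (update (update s k []) l ((s k).reverse ++ s l))
      (2 * (s k).length + 1) := by
  intro C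
  generalize hL : s k = L
  induction L generalizing s with
  | nil =>
    have h0 : update s k [] = s := by rw [← hL, update_eq_self]
    have : update (update s k []) l ([].reverse ++ s l) = s := by simp [h0]
    rw [this]
    exact (Exec.while_false (by simp [hL])).execIn
  | cons a r ih =>
    have h1 := Spec.move_cons hkl hL C
    have h2 := ih (update (update s k r) l (a :: s l)) (by simp [hkl])
    have h3 := ExecIn.while_step (P := Option.isSome) (by simp [hL]) h1 h2
    refine (h3.mono (by simp; omega)).imp fun t ht => ⟨ht.1, ?_⟩
    unfold Cmd.moveAll
    convert ht.2 using 2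
    funext k'
    by_cases h : k' = l
    · subst h; simp
    · by_cases h' : k' = k
      · subst h'; simp [h]
      · simp [h, h']

theorem Spec.clear (k : K) (s : K → List Γ') :
    Spec (clear k) s (update s k []) (2 * (s k).length + 1) := by
  intro C
  generalize hL : s k = L
  induction L generalizing s with
  | nil =>
    have : update s k [] = s := by rw [← hL, update_eq_self]
    rw [this]
    exact (Exec.while_false (by simp [hL])).execIn
  | cons a r ih =>
    have h1 := Spec.pop k s C
    have h2 := ih (update s k (s k).tail) (by simp [hL])
    rw [update_idem] at h2
    exact (ExecIn.while_step (P := Option.isSome) (by simp [hL]) h1 h2).mono (by simp; omega)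

theorem execIn_unload (k : K) (s : K → List Γ') (C : List Γ') :
    ExecIn (unload k) (withControl s C)
      (withControl (update s k []) (List.replicate (s k).length one ++ C))
      (3 * (s k).length + 1) := by
  generalize hL : s k = L
  induction L generalizing s C with
  | nil =>
    have : update s k [] = s := by rw [← hL, update_eq_self]
    rw [this]
    exact (Exec.while_false (by simp [hL])).execIn
  | cons a r ih =>
    have h1 := Spec.pop k s C
    have h2 := (Exec.push none one (withControl (update s k (s k).tail) C)).execIn
    rw [update_withControl_none, withControl_none] at h2
    have h3 := ih (update s k (s k).tail) (one :: C) (by simp [hL])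
    rw [update_idem] at h3
    have h4 := (ExecIn.while_step (P := Option.isSome) (by simp [hL]) (h1.seq h2) h3).mono
      (τ' := 3 * (a :: r).length + 1) (by simp; omega)
    rw [show List.replicate (a :: r).length one ++ C = List.replicate r.length one ++ one :: C by
      rw [List.length_cons, List.replicate_succ', List.append_assoc]; rfl]
    exact h4

/-- The body is specified for every control stack, so it can run on top of what is left of the
counter, and may itself contain counted loops. Each round costs a test, a pop and `τ`; at the end
there are one more test and the removal of the comma. The sequence `ss` lists the states between
rounds. -/
theorem execIn_repeatControl {c : Cmd (Option K)} {τ n : ℕ} (ss : ℕ → K → List Γ')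
    (h : ∀ j < n, Spec c (ss j) (ss (j + 1)) τ) (C : List Γ') :
    ExecIn (repeatControl c) (withControl (ss 0) (List.replicate n one ++ Γ'.comma :: C))
      (withControl (ss n) C) (n * (τ + 2) + 2) := by
  have key : ExecIn (loopWhile none (fun o => decide (o = some one)) (seq (pop none) c))
      (withControl (ss 0) (List.replicate n one ++ Γ'.comma :: C))
      (withControl (ss n) (Γ'.comma :: C)) (n * (τ + 2) + 1) := by
    induction n generalizing ss with
    | zero => exact (Exec.while_false (by simp)).execIn.mono (by simp)
    | succ n ih =>
      have h1 := (Exec.pop none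
        (withControl (ss 0) (List.replicate (n + 1) one ++ Γ'.comma :: C))).execIn
      rw [update_withControl_none] at h1
      have h2 := ih (fun j => ss (j + 1)) fun j hj => h (j + 1) (by omega)
      refine (ExecIn.while_step ?_ (h1.seq (h 0 (by omega) _)) h2).mono ?_
      · simp [List.replicate_succ]
      · ring_nf; omega
  have h1 := (Exec.pop none (withControl (ss n) (Γ'.comma :: C))).execIn
  rw [update_withControl_none] at h1
  exact key.seq h1

/-- Perform `c` as often as the height of the stack `k` says; `t` is an auxiliary stack. -/
def loop (t k : K) (c : Cmd (Option K)) : Cmd (Option K) :=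
  seq (push none Γ'.comma)
    (seq (loopWhile (some k) Option.isSome (seq (move (some k) (some t)) (push none one)))
      (seq (moveAll t k) (repeatControl c)))

/-- The height of `k` is copied to the control stack before the body runs, by moving `k` to `t` and
back; the two reversals cancel. Copying takes `5 * n + 3` steps, counting the separating comma, and
the repetition takes `n * (τ + 2) + 2`. -/
theorem Spec.loop {t k : K} (hkt : k ≠ t) {c : Cmd (Option K)} {τ n : ℕ} (ss : ℕ → K → List Γ')
    (ht : ss 0 t = []) (hn : (ss 0 k).length = n)
    (h : ∀ j < n, Spec c (ss j) (ss (j + 1)) τ) :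
    Spec (loop t k c) (ss 0) (ss n) (n * (τ + 7) + 5) := by
  intro C
  have h1 := (Exec.push none Γ'.comma (withControl (ss 0) C)).execIn
  rw [update_withControl_none] at h1
  have key : ∀ (L : List Γ') (s : K → List Γ') (C : List Γ'), s k = L →
      ExecIn (loopWhile (some k) Option.isSome (.seq (move (some k) (some t)) (.push none one)))
        (withControl s C) (withControl (update (update s k []) t (L.reverse ++ s t))
          (List.replicate L.length one ++ C)) (3 * L.length + 1) := by
    intro L
    induction L with
    | nil =>
      intro s C hL
      have h0 : update s k [] = s := by rw [← hL, update_eq_self]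
      have : update (update s k []) t ([].reverse ++ s t) = s := by simp [h0]
      rw [this]
      exact (Exec.while_false (by simp [hL])).execIn
    | cons a r ih =>
      intro s C hL
      have h1 := Spec.move_cons hkt hL C
      have h2 := (Exec.push none one
        (withControl (update (update s k r) t (a :: s t)) C)).execIn
      rw [update_withControl_none, withControl_none] at h2
      have h3 := ih (update (update s k r) t (a :: s t)) (one :: C) (by simp [hkt])
      have h4 := (ExecIn.while_step (P := Option.isSome) (by simp [hL]) (h1.seq h2) h3).mono
        (τ' := 3 * (a :: r).length + 1) (by simp; omega)
      rw [show List.replicate (a :: r).length one ++ C = List.replicate r.length one ++ one :: C by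
        rw [List.length_cons, List.replicate_succ', List.append_assoc]; rfl]
      refine h4.imp fun t' ht => ⟨ht.1, ?_⟩
      convert ht.2 using 2
      funext k'
      by_cases h : k' = t
      · subst h; simp
      · by_cases h' : k' = k
        · subst h'; simp [h]
        · simp [h, h']
  have h2 := key (ss 0 k) (ss 0) (Γ'.comma :: C) rfl
  have h3 := Spec.moveAll hkt.symm
    (update (update (ss 0) k []) t ((ss 0 k).reverse ++ ss 0 t))
    (List.replicate (ss 0 k).length one ++ Γ'.comma :: C)
  have h3' : update (update (update (update (ss 0) k []) t ((ss 0 k).reverse ++ ss 0 t)) t []) k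
      ((update (update (ss 0) k []) t ((ss 0 k).reverse ++ ss 0 t) t).reverse ++
        update (update (ss 0) k []) t ((ss 0 k).reverse ++ ss 0 t) k) = ss 0 := by
    funext k'
    by_cases h : k' = k
    · subst h; simp [hkt, ht]
    · by_cases h' : k' = t
      · subst h'; simp [h, ht]
      · simp [h, h']
  rw [h3'] at h3
  rw [hn] at h2 h3
  refine (h1.seq (h2.seq (h3.seq (execIn_repeatControl ss h C)))).mono ?_
  simp [ht, hn]
  ring_nf
  omega

end Cmd

end SinglePlateaued

namespace SinglePlateaued

open Computability Turing Function

/-! ### Bounded formulas and programs over a word and a memory -/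

/-- The stacks of the machine that evaluates formulas. -/
inductive Stack
  | input
  | memory
  | side
  | pass
  | count
  | answer
  | var (v : Fin 12)
  deriving DecidableEq, Fintype

/-- The stack contents that represent a word `w`, a memory `m` and an environment `e`, with the
auxiliary stacks `u` (skipped cells), `z` (a counter) and `r` (truth values). -/
def contents (w m u z r : List Γ') (e : Fin 12 → ℕ) : Stack → List Γ'
  | .input => w
  | .memory => m
  | .side => []
  | .pass => u
  | .count => z
  | .answer => r
  | .var v => List.replicate (e v) Cmd.one

section contents

variable (w m u z r l : List Γ') (e : Fin 12 → ℕ)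

@[simp] theorem contents_input : contents w m u z r e .input = w := rfl
@[simp] theorem contents_memory : contents w m u z r e .memory = m := rfl
@[simp] theorem contents_side : contents w m u z r e .side = [] := rfl
@[simp] theorem contents_pass : contents w m u z r e .pass = u := rfl
@[simp] theorem contents_count : contents w m u z r e .count = z := rfl
@[simp] theorem contents_answer : contents w m u z r e .answer = r := rfl
@[simp] theorem contents_var (v : Fin 12) :
    contents w m u z r e (.var v) = List.replicate (e v) Cmd.one := rfl

@[simp] theorem update_contents_input :
    update (contents w m u z r e) .input l = contents l m u z r e := by
  funext k; cases k <;> simp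

@[simp] theorem update_contents_memory :
    update (contents w m u z r e) .memory l = contents w l u z r e := by
  funext k; cases k <;> simp

@[simp] theorem update_contents_pass :
    update (contents w m u z r e) .pass l = contents w m l z r e := by
  funext k; cases k <;> simp

@[simp] theorem update_contents_count :
    update (contents w m u z r e) .count l = contents w m u l r e := by
  funext k; cases k <;> simp

@[simp] theorem update_contents_answer :
    update (contents w m u z r e) .answer l = contents w m u z l e := by
  funext k; cases k <;> simp

theorem update_contents_var (v : Fin 12) (n : ℕ) :
    update (contents w m u z r e) (.var v) (List.replicate n Cmd.one) =
      contents w m u z r (update e v n) := by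
  funext k
  cases k with
  | var v' =>
    by_cases h : v' = v
    · subst h; simp
    · simp [h]
  | _ => simp

theorem update_contents_var_nil (v : Fin 12) :
    update (contents w m u z r e) (.var v) [] = contents w m u z r (update e v 0) :=
  update_contents_var w m u z r e v 0

end contents

/-- Terms for natural numbers: variables, the length of the word, and arithmetic. -/
inductive Term
  | var (v : Fin 12)
  | len
  | one
  | add (t t' : Term)
  | mul (t t' : Term)

namespace Term

/-- The value of a term. -/
def value (w : List Γ') (e : Fin 12 → ℕ) : Term → ℕ
  | var v => e v
  | len => w.length
  | one => 1
  | add t t' => t.value w e + t'.value w e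
  | mul t t' => t.value w e * t'.value w e

/-- A program that performs `c` as often as the value of the term says. -/
def gen : Term → Cmd (Option Stack) → Cmd (Option Stack)
  | var v, c => Cmd.loop .side (.var v) c
  | len, c => Cmd.loop .side .input c
  | one, c => c
  | add t t', c => .seq (t.gen c) (t'.gen c)
  | mul t t', c => t.gen (t'.gen c)

/-- One number `N` bounds the word and all variables, so that the polynomial depends on the term
alone. -/
theorem exists_value_le (t : Term) : ∃ p : Polynomial ℕ, ∀ (N : ℕ) (w : List Γ') (e : Fin 12 → ℕ),
    w.length ≤ N → (∀ v, e v ≤ N) → t.value w e ≤ p.eval N := by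
  induction t with
  | var v => exact ⟨Polynomial.X, fun N w e _ he => by simpa [value] using he v⟩
  | len => exact ⟨Polynomial.X, fun N w e hw _ => by simpa [value] using hw⟩
  | one => exact ⟨1, fun N w e _ _ => by simp [value]⟩
  | add t t' ih ih' =>
    obtain ⟨p, hp⟩ := ih
    obtain ⟨p', hp'⟩ := ih'
    exact ⟨p + p', fun N w e hw he => by
      simpa [value] using Nat.add_le_add (hp N w e hw he) (hp' N w e hw he)⟩
  | mul t t' ih ih' =>
    obtain ⟨p, hp⟩ := ih
    obtain ⟨p', hp'⟩ := ih'
    exact ⟨p * p', fun N w e hw he => by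
      simpa [value] using Nat.mul_le_mul (hp N w e hw he) (hp' N w e hw he)⟩

/-- The stacks that the evaluation of terms uses hold the word `w` and the environment `e`. -/
structure IsFrame (w : List Γ') (e : Fin 12 → ℕ) (s : Stack → List Γ') : Prop where
  side : s .side = []
  input : s .input = w
  var : ∀ v, s (.var v) = List.replicate (e v) Cmd.one

/-- Sums become consecutive loops and products nested loops, so no value is ever written down. For
this, the stacks that the loops count by must be intact between any two runs of `c`, which is the
role of `IsFrame`. The time is stated as a multiple of `τ + 1` rather than of `τ` so that it also
absorbs the overhead of the loops. -/
theorem exists_spec_gen (t : Term) : ∃ p : Polynomial ℕ,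
    ∀ (N : ℕ) (w : List Γ') (e : Fin 12 → ℕ), w.length ≤ N → (∀ v, e v ≤ N) →
    ∀ (c : Cmd (Option Stack)) (τ : ℕ) (ss : ℕ → Stack → List Γ'),
      (∀ j ≤ t.value w e, IsFrame w e (ss j)) →
      (∀ j < t.value w e, c.Spec (ss j) (ss (j + 1)) τ) →
      (t.gen c).Spec (ss 0) (ss (t.value w e)) (p.eval N * (τ + 1)) := by
  induction t with
  | var v =>
    refine ⟨7 * Polynomial.X + 5, fun N w e hw he c τ ss hs hc => ?_⟩
    refine (Cmd.Spec.loop (by simp) ss (hs 0 (by simp)).side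
      (by rw [(hs 0 (by simp)).var, List.length_replicate]; rfl) hc).mono ?_
    have := Nat.mul_le_mul_right (τ + 7) (he v)
    simp [value]
    nlinarith
  | len =>
    refine ⟨7 * Polynomial.X + 5, fun N w e hw he c τ ss hs hc => ?_⟩
    refine (Cmd.Spec.loop (by simp) ss (hs 0 (by simp)).side
      (by rw [(hs 0 (by simp)).input]; rfl) hc).mono ?_
    have := Nat.mul_le_mul_right (τ + 7) hw
    simp [value]
    nlinarith
  | one =>
    exact ⟨1, fun N w e hw he c τ ss hs hc => (hc 0 (by simp [value])).mono (by simp)⟩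
  | add t t' ih ih' =>
    obtain ⟨p, hp⟩ := ih
    obtain ⟨p', hp'⟩ := ih'
    refine ⟨p + p', fun N w e hw he c τ ss hs hc => ?_⟩
    simp only [value] at hs hc ⊢
    refine ((hp N w e hw he c τ ss (fun j hj => hs j (by omega))
      (fun j hj => hc j (by omega))).seq
      (hp' N w e hw he c τ (fun j => ss (t.value w e + j)) (fun j hj => hs _ (by omega))
      (fun j hj => hc _ (by omega)))).mono ?_
    simp [add_mul]
  | mul t t' ih ih' =>
    obtain ⟨p, hp⟩ := ih
    obtain ⟨p', hp'⟩ := ih'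
    refine ⟨p * (p' + 1), fun N w e hw he c τ ss hs hc => ?_⟩
    simp only [value] at hs hc ⊢
    set n := t.value w e
    set n' := t'.value w e
    -- The state after `j` inner rounds of the outer round `i` has the overall index `i * n' + j`.
    have hle : ∀ i < n, ∀ j ≤ n', i * n' + j ≤ n * n' := fun i hi j hj => by
      have := Nat.mul_le_mul_right n' (show i + 1 ≤ n by omega)
      rw [add_mul] at this
      omega
    have h := hp N w e hw he (t'.gen c) (p'.eval N * (τ + 1)) (fun i => ss (i * n'))
      (fun i hi => hs _ (Nat.mul_le_mul_right _ hi)) fun i hi => by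
        have h1 := hp' N w e hw he c τ (fun j => ss (i * n' + j)) (fun j hj => hs _ (hle i hi j hj))
          fun j hj => hc (i * n' + j) (by have := hle i hi (j + 1) hj; omega)
        simpa [add_mul] using h1
    rw [zero_mul] at h
    refine h.mono ?_
    simp only [Polynomial.eval_mul, Polynomial.eval_add, Polynomial.eval_one, mul_assoc]
    refine Nat.mul_le_mul_left _ ?_
    nlinarith

end Term

namespace Cmd

/-- Count up to the value of a term on the counter stack. -/
def countTo (t : Term) : Cmd (Option Stack) := t.gen (push (some .count) one)

theorem exists_spec_countTo (t : Term) : ∃ p : Polynomial ℕ,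
    ∀ (N : ℕ) (w m r : List Γ') (e : Fin 12 → ℕ), w.length ≤ N → (∀ v, e v ≤ N) →
      (countTo t).Spec (contents w m [] [] r e)
        (contents w m [] (List.replicate (t.value w e) one) r e) (p.eval N) := by
  obtain ⟨p, hp⟩ := t.exists_spec_gen
  refine ⟨p * 2, fun N w m r e hw he => ?_⟩
  have := hp N w e hw he (push (some .count) one) 1
    (fun j => contents w m [] (List.replicate j one) r e) (fun j _ => ⟨rfl, rfl, fun _ => rfl⟩)
    fun j _ => (Spec.push _ _ _).congr_right (by simp [List.replicate_succ])
  rw [countTo]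
  simpa using this

/-- Skip as many cells of the stack `k` as the counter says. -/
def seek (k : Stack) : Cmd (Option Stack) :=
  loopWhile (some .count) Option.isSome (seq (pop (some .count)) (move (some k) (some .pass)))

/-- A move from an empty stack does nothing but still takes a step; this agrees with the truncation
in `drop` and `take`, so `n` may exceed the length. A test, a pop and a move are spent on each unit
of the counter. -/
theorem spec_seek_memory (w m u r : List Γ') (e : Fin 12 → ℕ) (n : ℕ) :
    (seek .memory).Spec (contents w m u (List.replicate n one) r e)
      (contents w (m.drop n) ((m.take n).reverse ++ u) [] r e) (3 * n + 1) := by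
  intro C
  induction n generalizing m u with
  | zero => exact (Exec.while_false (by simp)).execIn.mono (by simp)
  | succ n ih =>
    have h1 := Spec.pop (Stack.count) (contents w m u (List.replicate (n + 1) one) r e) C
    simp only [update_contents_count, contents_count, List.tail_replicate,
      Nat.add_sub_cancel] at h1
    refine ExecIn.mono (τ := 1 + (1 + 1 + (3 * n + 1))) ?_ (by omega)
    cases m with
    | nil =>
      have h2 := Spec.move_nil (k := Stack.memory) .pass
        (s := contents w [] u (List.replicate n one) r e) rfl C
      have := ih [] u
      simp only [List.drop_nil, List.take_nil, List.reverse_nil, List.nil_append] at this ⊢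
      exact ExecIn.while_step (by simp [List.replicate_succ]) (h1.seq h2) this
    | cons a m =>
      have h2 := Spec.move_cons (k := Stack.memory) (l := .pass) (by simp)
        (s := contents w (a :: m) u (List.replicate n one) r e) rfl C
      simp only [update_contents_memory, update_contents_pass, contents_pass] at h2
      have := ih m (a :: u)
      simp only [List.drop_succ_cons, List.take_succ_cons, List.reverse_cons, List.append_assoc,
        List.singleton_append]
      exact ExecIn.while_step (by simp [List.replicate_succ]) (h1.seq h2) this

theorem spec_seek_input (w m u r : List Γ') (e : Fin 12 → ℕ) (n : ℕ) :
    (seek .input).Spec (contents w m u (List.replicate n one) r e)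
      (contents (w.drop n) m ((w.take n).reverse ++ u) [] r e) (3 * n + 1) := by
  intro C
  induction n generalizing w u with
  | zero => exact (Exec.while_false (by simp)).execIn.mono (by simp)
  | succ n ih =>
    have h1 := Spec.pop (Stack.count) (contents w m u (List.replicate (n + 1) one) r e) C
    simp only [update_contents_count, contents_count, List.tail_replicate,
      Nat.add_sub_cancel] at h1
    refine ExecIn.mono (τ := 1 + (1 + 1 + (3 * n + 1))) ?_ (by omega)
    cases w with
    | nil =>
      have h2 := Spec.move_nil (k := Stack.input) .pass
        (s := contents [] m u (List.replicate n one) r e) rfl C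
      have := ih [] u
      simp only [List.drop_nil, List.take_nil, List.reverse_nil, List.nil_append] at this ⊢
      exact ExecIn.while_step (by simp [List.replicate_succ]) (h1.seq h2) this
    | cons a w =>
      have h2 := Spec.move_cons (k := Stack.input) (l := .pass) (by simp)
        (s := contents (a :: w) m u (List.replicate n one) r e) rfl C
      simp only [update_contents_input, update_contents_pass, contents_pass] at h2
      have := ih w (a :: u)
      simp only [List.drop_succ_cons, List.take_succ_cons, List.reverse_cons, List.append_assoc,
        List.singleton_append]
      exact ExecIn.while_step (by simp [List.replicate_succ]) (h1.seq h2) this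

/-- Perform `c` with the variable `v` running through the numbers below the length of the word;
the value of the variable is saved on the control stack. -/
def scan (v : Fin 12) (c : Cmd (Option Stack)) : Cmd (Option Stack) :=
  seq (push none Γ'.comma) (seq (unload (.var v))
    (seq (loop .side .input (seq c (push (some (.var v)) one)))
      (seq (clear (.var v)) (repeatControl (push (some (.var v)) one)))))

/-- The old value of `v` waits in unary on the control stack below the loop counter, so quantifiers
may rebind a variable. The body changes the memory when it comes from a program and the answers when
it comes from a formula; `mm` and `rr` follow both. -/
theorem Spec.scan {v : Fin 12} {c : Cmd (Option Stack)} {w : List Γ'} {e : Fin 12 → ℕ} {τ : ℕ}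
    (mm rr : ℕ → List Γ')
    (h : ∀ j < w.length, c.Spec (contents w (mm j) [] [] (rr j) (update e v j))
      (contents w (mm (j + 1)) [] [] (rr (j + 1)) (update e v j)) τ) :
    (scan v c).Spec (contents w (mm 0) [] [] (rr 0) e)
      (contents w (mm w.length) [] [] (rr w.length) e) (w.length * (τ + 10) + 6 * e v + 10) := by
  intro C
  have h1 := (Exec.push none Γ'.comma (withControl (contents w (mm 0) [] [] (rr 0) e) C)).execIn
  rw [update_withControl_none] at h1
  have h2 := execIn_unload (.var v) (contents w (mm 0) [] [] (rr 0) e) (Γ'.comma :: C)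
  rw [update_contents_var_nil, contents_var, List.length_replicate] at h2
  have h3 := Spec.loop (t := .side) (k := .input) (by simp)
    (c := .seq c (.push (some (.var v)) one))
    (τ := τ + 1) (fun j => contents w (mm j) [] [] (rr j) (update e v j)) rfl rfl
    (fun j hj => (h j hj).seq ((Spec.push _ _ _).congr_right (by
      rw [contents_var, ← List.replicate_succ, update_contents_var]; simp)))
    (List.replicate (e v) one ++ Γ'.comma :: C)
  have h4 := Spec.clear (.var v) (contents w (mm w.length) [] [] (rr w.length)
    (update e v w.length)) (List.replicate (e v) one ++ Γ'.comma :: C)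
  rw [update_contents_var_nil, update_idem, contents_var, List.length_replicate, update_self] at h4
  have h5 := execIn_repeatControl (c := .push (some (.var v)) one) (n := e v) (τ := 1)
    (fun j => contents w (mm w.length) [] [] (rr w.length) (update e v j))
    (fun j _ => (Spec.push _ _ _).congr_right (by
      rw [contents_var, ← List.replicate_succ, update_contents_var]; simp)) C
  rw [update_eq_self] at h5
  refine (h1.seq (h2.seq (h3.seq (h4.seq h5)))).mono ?_
  simp only [contents_input]
  ring_nf
  omega

end Cmd

/-- Formulas with bounded quantifiers about a word and a memory. -/
inductive Fm
  | le (t t' : Term)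
  | inp (t : Term) (P : Option Γ' → Bool)
  | mem (t : Term)
  | neg (φ : Fm)
  | and (φ ψ : Fm)
  | all (v : Fin 12) (φ : Fm)

open Classical in
/-- The symbol for the truth value of a proposition. -/
noncomputable def truth (p : Prop) : Γ' := Γ'.bit (decide p)

namespace Fm

/-- The truth of a formula; the quantifier runs through the numbers below the length of the
word. -/
def Holds (w m : List Γ') : (Fin 12 → ℕ) → Fm → Prop
  | e, le t t' => t.value w e ≤ t'.value w e
  | e, inp t P => P w[t.value w e]? = true
  | e, mem t => m[t.value w e]? = some Cmd.one
  | e, neg φ => ¬ φ.Holds w m e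
  | e, and φ ψ => φ.Holds w m e ∧ ψ.Holds w m e
  | e, all v φ => ∀ k < w.length, φ.Holds w m (update e v k)

open Cmd in
/-- Replace the two topmost truth values by their conjunction. -/
def conjunction : Cmd (Option Stack) :=
  ite (some .answer) (fun o => decide (o = some one)) (pop (some .answer))
    (seq (pop (some .answer)) (seq (pop (some .answer)) (push (some .answer) (Γ'.bit false))))

open Cmd in
/-- A program that puts the truth value of a formula on the answer stack. -/
def comp : Fm → Cmd (Option Stack)
  | le t t' =>
    seq (countTo t) (seq (t'.gen (pop (some .count)))
      (seq (ite (some .count) Option.isNone (push (some .answer) one)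
        (push (some .answer) (Γ'.bit false))) (clear .count)))
  | inp t P =>
    seq (countTo t) (seq (seek .input)
      (seq (ite (some .input) P (push (some .answer) one)
        (push (some .answer) (Γ'.bit false))) (moveAll .pass .input)))
  | mem t =>
    seq (countTo t) (seq (seek .memory)
      (seq (ite (some .memory) (fun o => decide (o = some one)) (push (some .answer) one)
        (push (some .answer) (Γ'.bit false))) (moveAll .pass .memory)))
  | neg φ =>
    seq φ.comp (ite (some .answer) (fun o => decide (o = some one))
      (seq (pop (some .answer)) (push (some .answer) (Γ'.bit false)))
      (seq (pop (some .answer)) (push (some .answer) one)))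
  | and φ ψ => seq φ.comp (seq ψ.comp conjunction)
  | all v φ => seq (push (some .answer) one) (scan v (seq φ.comp conjunction))

theorem truth_of {p : Prop} (h : p) : truth p = Cmd.one := by simp [truth, h]

theorem truth_of_not {p : Prop} (h : ¬ p) : truth p = Γ'.bit false := by simp [truth, h]

theorem truth_eq_one {p : Prop} : truth p = Cmd.one ↔ p := by simp [truth]

theorem spec_conjunction (w m r : List Γ') (e : Fin 12 → ℕ) (p q : Prop) :
    conjunction.Spec (contents w m [] [] (truth q :: truth p :: r) e)
      (contents w m [] [] (truth (p ∧ q) :: r) e) 4 := by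
  refine (Cmd.Spec.ite (τ := 3) _ (fun h => ?_) fun h => ?_).mono (by norm_num)
  · have hq : q := by simpa [truth_eq_one] using of_decide_eq_true h
    refine ((Cmd.Spec.pop _ _).congr_right ?_).mono (by norm_num)
    simp [hq]
  · have hq : ¬ q := by simpa [truth_eq_one] using of_decide_eq_false h
    refine ((Cmd.Spec.pop _ _).seq ((Cmd.Spec.pop _ _).seq
      ((Cmd.Spec.push _ _ _).congr_right ?_))).mono (by norm_num)
    simp [hq, truth_of_not]

theorem spec_answer (k : Stack) (P : Option Γ' → Bool) (w m u z r : List Γ') (e : Fin 12 → ℕ)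
    (p : Prop) (h : P (contents w m u z r e k).head? = true ↔ p) :
    (Cmd.ite (some k) P (.push (some .answer) Cmd.one)
      (.push (some .answer) (Γ'.bit false))).Spec (contents w m u z r e)
      (contents w m u z (truth p :: r) e) 2 := by
  refine Cmd.Spec.ite (τ := 1) _ (fun h' => ?_) fun h' => ?_
  · rw [truth_of (h.1 h')]
    exact (Cmd.Spec.push _ _ _).congr_right (by simp)
  · rw [truth_of_not (fun h'' => by simp [h.2 h''] at h')]
    exact (Cmd.Spec.push _ _ _).congr_right (by simp)

/-- Evaluation restores everything but the answer stack, and a bound variable takes values below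
`w.length ≤ N`. The same `N` thus serves all subformulas, and every connective combines polynomials
into a polynomial. -/
theorem exists_spec (φ : Fm) : ∃ p : Polynomial ℕ,
    ∀ (N : ℕ) (w m r : List Γ') (e : Fin 12 → ℕ), w.length ≤ N → m.length ≤ N → (∀ v, e v ≤ N) →
      φ.comp.Spec (contents w m [] [] r e)
        (contents w m [] [] (truth (φ.Holds w m e) :: r) e) (p.eval N) := by
  induction φ with
  | le t t' =>
    obtain ⟨p, hp⟩ := Cmd.exists_spec_countTo t
    obtain ⟨q, hq⟩ := t.exists_value_le
    obtain ⟨p', hp'⟩ := t'.exists_spec_gen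
    refine ⟨p + (p' * 2 + (2 + (2 * q + 1))), fun N w m r e hw hm he => ?_⟩
    -- Popping the counter once for each unit of `t'` leaves the truncated difference, which is zero
    -- exactly if `t ≤ t'`.
    have h2 := hp' N w e hw he (.pop (some .count)) 1
      (fun j => contents w m [] (List.replicate (t.value w e - j) Cmd.one) r e)
      (fun j _ => ⟨rfl, rfl, fun _ => rfl⟩)
      fun j _ => (Cmd.Spec.pop _ _).congr_right (by simp [Nat.sub_add_eq])
    have h3 := spec_answer .count Option.isNone w m []
      (List.replicate (t.value w e - t'.value w e) Cmd.one) r e (t.value w e ≤ t'.value w e)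
      (by simp [Nat.sub_eq_zero_iff_le])
    have h4 := (Cmd.Spec.clear .count (contents w m []
      (List.replicate (t.value w e - t'.value w e) Cmd.one)
      (truth (t.value w e ≤ t'.value w e) :: r) e)).mono (τ' := 2 * q.eval N + 1) (by
        have := hq N w e hw he
        simp; omega)
    refine ((hp N w m r e hw he).seq (h2.seq (h3.seq (h4.congr_right (by simp [Holds]))))).mono ?_
    simp
  | inp t P =>
    obtain ⟨p, hp⟩ := Cmd.exists_spec_countTo t
    obtain ⟨q, hq⟩ := t.exists_value_le
    refine ⟨p + (3 * q + 1 + (2 + (2 * q + 1))), fun N w m r e hw hm he => ?_⟩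
    have hv := hq N w e hw he
    have h2 := (Cmd.spec_seek_input w m [] r e (t.value w e)).mono (τ' := 3 * q.eval N + 1)
      (by omega)
    have h3 := spec_answer .input P (w.drop (t.value w e)) m
      ((w.take (t.value w e)).reverse ++ []) [] r e (P w[t.value w e]? = true) (by simp)
    have h4 := (Cmd.Spec.moveAll (k := .pass) (l := .input) (by simp)
      (contents (w.drop (t.value w e)) m ((w.take (t.value w e)).reverse ++ []) []
        (truth (P w[t.value w e]? = true) :: r) e)).mono (τ' := 2 * q.eval N + 1) (by
        simp; omega)
    refine ((hp N w m r e hw he).seq (h2.seq (h3.seq (h4.congr_right (by simp [Holds]))))).mono ?_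
    simp
  | mem t =>
    obtain ⟨p, hp⟩ := Cmd.exists_spec_countTo t
    obtain ⟨q, hq⟩ := t.exists_value_le
    refine ⟨p + (3 * q + 1 + (2 + (2 * q + 1))), fun N w m r e hw hm he => ?_⟩
    have hv := hq N w e hw he
    have h2 := (Cmd.spec_seek_memory w m [] r e (t.value w e)).mono (τ' := 3 * q.eval N + 1)
      (by omega)
    have h3 := spec_answer .memory (fun o => decide (o = some Cmd.one)) w (m.drop (t.value w e))
      ((m.take (t.value w e)).reverse ++ []) [] r e (m[t.value w e]? = some Cmd.one) (by simp)
    have h4 := (Cmd.Spec.moveAll (k := .pass) (l := .memory) (by simp)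
      (contents w (m.drop (t.value w e)) ((m.take (t.value w e)).reverse ++ []) []
        (truth (m[t.value w e]? = some Cmd.one) :: r) e)).mono (τ' := 2 * q.eval N + 1) (by
        simp; omega)
    refine ((hp N w m r e hw he).seq (h2.seq (h3.seq (h4.congr_right (by simp [Holds]))))).mono ?_
    simp
  | neg φ ih =>
    obtain ⟨p, hp⟩ := ih
    refine ⟨p + 3, fun N w m r e hw hm he => ?_⟩
    refine ((hp N w m r e hw hm he).seq (τ' := 3) ?_).mono (by simp)
    refine Cmd.Spec.ite (τ := 2) _ (fun h => ?_) fun h => ?_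
    · have h' : φ.Holds w m e := by simpa [truth_eq_one] using of_decide_eq_true h
      exact (Cmd.Spec.pop _ _).seq ((Cmd.Spec.push _ _ _).congr_right
        (by simp [Holds, h', truth_of_not]))
    · have h' : ¬ φ.Holds w m e := by simpa [truth_eq_one] using of_decide_eq_false h
      exact (Cmd.Spec.pop _ _).seq ((Cmd.Spec.push _ _ _).congr_right
        (by simp [Holds, h', truth_of]))
  | and φ ψ ih ih' =>
    obtain ⟨p, hp⟩ := ih
    obtain ⟨p', hp'⟩ := ih'
    refine ⟨p + (p' + 4), fun N w m r e hw hm he => ?_⟩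
    exact ((hp N w m r e hw hm he).seq ((hp' N w m _ e hw hm he).seq
      (spec_conjunction w m r e _ _))).mono (by simp)
  | all v φ ih =>
    obtain ⟨p, hp⟩ := ih
    refine ⟨1 + (Polynomial.X * (p + 4 + 10) + 6 * Polynomial.X + 10),
      fun N w m r e hw hm he => ?_⟩
    have h1 := Cmd.Spec.push .answer Cmd.one (contents w m [] [] r e)
    -- Before round `j` the top answer is the truth value of the formula for all `k < j`; it starts
    -- with the empty conjunction, which is true.
    have h2 := Cmd.Spec.scan (v := v) (c := .seq φ.comp conjunction) (w := w) (e := e)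
      (τ := p.eval N + 4) (fun _ => m)
      (fun j => truth (∀ k < j, φ.Holds w m (update e v k)) :: r) fun j hj => by
        refine ((hp N w m _ (update e v j) hw hm fun v' => ?_).seq
          (spec_conjunction w m r _ _ _)).congr_right ?_
        · by_cases h : v' = v
          · subst h; simp; omega
          · simpa [h] using he v'
        · congr 2
          simp only [Nat.lt_succ_iff_lt_or_eq, or_imp, forall_and, forall_eq]
    refine (h1.seq (h2.congr_left (by simp [truth_of]))).mono ?_
    have h3 := Nat.mul_le_mul_right (p.eval N + 4 + 10) hw
    have h4 := he v
    simp
    omega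

end Fm

/-- Programs that write into the memory. -/
inductive Prog
  | set (t : Term)
  | cond (φ : Fm) (p : Prog)
  | each (v : Fin 12) (p : Prog)
  | times (t : Term) (p : Prog)

namespace Prog

open Classical in
/-- The effect of a program on the memory. -/
noncomputable def run (w : List Γ') : Prog → (Fin 12 → ℕ) → List Γ' → List Γ'
  | set t, e, m => m.set (t.value w e) Cmd.one
  | cond φ p, e, m => if φ.Holds w m e then p.run w e m else m
  | each v p, e, m =>
    (List.range w.length).foldl (fun m k => p.run w (update e v k) m) m
  | times t p, e, m => (p.run w e)^[t.value w e] m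

theorem foldl_length {α β : Type*} (f : List β → α → List β) (hf : ∀ m a, (f m a).length = m.length)
    (l : List α) (m : List β) : (l.foldl f m).length = m.length := by
  induction l generalizing m with
  | nil => rfl
  | cons a l ih => rw [List.foldl_cons, ih, hf]

theorem iterate_length {β : Type*} (f : List β → List β) (hf : ∀ m, (f m).length = m.length)
    (n : ℕ) (m : List β) : (f^[n] m).length = m.length := by
  induction n with
  | zero => rfl
  | succ n ih => rw [iterate_succ_apply', hf, ih]

theorem length_run (w : List Γ') (p : Prog) (e : Fin 12 → ℕ) (m : List Γ') :
    (p.run w e m).length = m.length := by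
  induction p generalizing e m with
  | set t => simp [run]
  | cond φ p ih =>
    rw [run]
    split_ifs
    · exact ih e m
    · rfl
  | each v p ih => exact foldl_length _ (fun m k => ih _ m) _ _
  | times t p ih => exact iterate_length _ (ih e) _ _

open Cmd in
/-- The stack program for a program. -/
def comp : Prog → Cmd (Option Stack)
  | set t =>
    seq (countTo t) (seq (seek .memory)
      (seq (ite (some .memory) Option.isSome
        (seq (pop (some .memory)) (push (some .memory) one)) skip) (moveAll .pass .memory)))
  | cond φ p =>
    seq φ.comp (ite (some .answer) (fun o => decide (o = some one))
      (seq (pop (some .answer)) p.comp) (pop (some .answer)))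
  | each v p => scan v p.comp
  | times t p => t.gen p.comp

/-- By `length_run` the memory never changes its length, so the bound `N` and the cost of a single
run of the body stay the same throughout `each` and `times`. -/
theorem exists_spec (p : Prog) : ∃ q : Polynomial ℕ,
    ∀ (N : ℕ) (w m r : List Γ') (e : Fin 12 → ℕ), w.length ≤ N → m.length ≤ N → (∀ v, e v ≤ N) →
      p.comp.Spec (contents w m [] [] r e) (contents w (p.run w e m) [] [] r e) (q.eval N) := by
  induction p with
  | set t =>
    obtain ⟨p, hp⟩ := Cmd.exists_spec_countTo t
    obtain ⟨q, hq⟩ := t.exists_value_le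
    refine ⟨p + (3 * q + 1 + (3 + (2 * q + 1))), fun N w m r e hw hm he => ?_⟩
    have hv := hq N w e hw he
    set n := t.value w e with hn
    have h2 := (Cmd.spec_seek_memory w m [] r e n).mono (τ' := 3 * q.eval N + 1) (by omega)
    have h3 : (Cmd.ite (some Stack.memory) Option.isSome
        (.seq (.pop (some Stack.memory)) (.push (some Stack.memory) Cmd.one)) .skip).Spec
        (contents w (m.drop n) ((m.take n).reverse ++ []) [] r e)
        (contents w ((m.set n Cmd.one).drop n) ((m.take n).reverse ++ []) [] r e) 3 := by
      refine Cmd.Spec.ite (τ := 2) _ (fun h => ?_) fun h => ?_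
      · refine ((Cmd.Spec.pop _ _).seq (Cmd.Spec.push _ _ _)).congr_right ?_
        have h' : n < m.length := by simpa using h
        rw [List.drop_eq_getElem_cons (l := m.set n Cmd.one) (by simpa using h')]
        simp [List.drop_set_of_lt]
      · have h' : m.length ≤ n := by simpa using h
        rw [List.set_eq_of_length_le h']
        exact (Cmd.Spec.skip _).mono (by norm_num)
    have h4 := (Cmd.Spec.moveAll (k := .pass) (l := .memory) (by simp)
      (contents w ((m.set n Cmd.one).drop n) ((m.take n).reverse ++ []) [] r e)).mono
      (τ' := 2 * q.eval N + 1) (by simp; omega)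
    refine ((hp N w m r e hw he).seq (h2.seq (h3.seq (h4.congr_right ?_)))).mono ?_
    · have : m.take n = (m.set n Cmd.one).take n := by simp [List.take_set_of_le]
      simp only [contents_pass, contents_memory, update_contents_pass, update_contents_memory,
        List.append_nil, List.reverse_reverse, run, ← hn]
      rw [this, List.take_append_drop]
    · simp
  | cond φ p ih =>
    obtain ⟨q, hq⟩ := φ.exists_spec
    obtain ⟨q', hq'⟩ := ih
    refine ⟨q + (1 + (1 + q')), fun N w m r e hw hm he => ?_⟩
    refine ((hq N w m r e hw hm he).seq (τ' := 1 + (1 + q'.eval N)) ?_).mono (by simp)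
    refine Cmd.Spec.ite _ (fun h => ?_) fun h => ?_
    · have h' : φ.Holds w m e := by simpa [Fm.truth_eq_one] using of_decide_eq_true h
      refine (Cmd.Spec.pop _ _).seq (((hq' N w m r e hw hm he).congr_left ?_).congr_right ?_)
      · simp
      · simp [run, h']
    · have h' : ¬ φ.Holds w m e := by simpa [Fm.truth_eq_one] using of_decide_eq_false h
      exact ((Cmd.Spec.pop _ _).congr_right (by simp [run, h'])).mono (by omega)
  | each v p ih =>
    obtain ⟨q, hq⟩ := ih
    refine ⟨Polynomial.X * (q + 10) + 6 * Polynomial.X + 10, fun N w m r e hw hm he => ?_⟩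
    have h := Cmd.Spec.scan (v := v) (c := p.comp) (w := w) (e := e) (τ := q.eval N)
      (fun j => (List.range j).foldl (fun m k => p.run w (update e v k) m) m) (fun _ => r)
      fun j hj => by
        refine (hq N w _ r (update e v j) hw ?_ fun v' => ?_).congr_right ?_
        · rw [foldl_length _ fun m k => length_run w p _ m]; exact hm
        · by_cases h : v' = v
          · subst h; simp; omega
          · simpa [h] using he v'
        · rw [List.range_succ, List.foldl_append]; rfl
    refine h.mono ?_
    have h3 := Nat.mul_le_mul_right (q.eval N + 10) hw
    have h4 := he v
    simp
    omega
  | times t p ih =>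
    obtain ⟨q, hq⟩ := t.exists_spec_gen
    obtain ⟨q', hq'⟩ := ih
    refine ⟨q * (q' + 1), fun N w m r e hw hm he => ?_⟩
    have h := hq N w e hw he p.comp (q'.eval N)
      (fun j => contents w ((p.run w e)^[j] m) [] [] r e) (fun j _ => ⟨rfl, rfl, fun _ => rfl⟩)
      fun j _ => (hq' N w _ r e hw (by
        rw [iterate_length _ (length_run w p e)]; exact hm) he).congr_right (by
        rw [iterate_succ_apply'])
    exact h.mono (by simp)

end Prog

end SinglePlateaued

/-! ### Marking programs: membership in P, fixed points and invariants. -/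

namespace SinglePlateaued

open Computability Turing Function

/-- A language is in P if membership is expressed by a formula that is evaluated after a program
has filled a memory whose size is the fourth power of the length of the word (extended by a
blank). -/
theorem inP_of_prog {L : Language Γ'} (p : Prog) (φ : Fm)
    (h : ∀ w : List Γ', w ∈ L ↔ φ.Holds (Γ'.blank :: w) (p.run (Γ'.blank :: w) (fun _ => 0)
      (List.replicate ((w.length + 1) ^ 4) Γ'.blank)) (fun _ => 0)) : InP L := by
  classical
  let t : Term := .mul (.mul (.mul .len .len) .len) .len
  obtain ⟨q₁, hq₁⟩ := t.exists_spec_gen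
  obtain ⟨q₂, hq₂⟩ := p.exists_spec
  obtain ⟨q₃, hq₃⟩ := φ.exists_spec
  -- The size of the memory serves as the common bound `N` for the extended word, the memory and the
  -- variables, which are all zero.
  let B : Polynomial ℕ := (Polynomial.X + 1) ^ 4
  refine Cmd.inP_of_exec (fun w => decide (w ∈ L)) (fun w => by simp)
    (.seq (.push (some .input) Γ'.blank) (.seq (t.gen (.push (some .memory) Γ'.blank))
      (.seq p.comp (.seq φ.comp (.seq (Cmd.clear .input) (Cmd.clear .memory))))))
    (some .input) (some .answer)
    (1 + (q₁.comp B * 2 + (q₂.comp B + (q₃.comp B + ((2 * B + 1) + (2 * B + 1)))))) fun w => ?_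
  set w' := Γ'.blank :: w with hw'
  set N := (w.length + 1) ^ 4 with hN
  have hB : B.eval w.length = N := by simp [B, hN]
  have hlen : w'.length ≤ N := by
    rw [hw', List.length_cons, hN]
    exact Nat.le_self_pow (by norm_num) _
  have ht : t.value w' (fun _ => 0) = N := by
    simp only [t, Term.value, hw', List.length_cons, hN]
    ring
  set m := p.run w' (fun _ => 0) (List.replicate N Γ'.blank) with hm
  have hml : m.length = N := by rw [hm, Prog.length_run, List.length_replicate]
  have h1 : Cmd.Spec (.push (some .input) Γ'.blank) (contents w [] [] [] [] fun _ => 0)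
      (contents w' [] [] [] [] fun _ => 0) 1 :=
    (Cmd.Spec.push _ _ _).congr_right (by simp [hw'])
  have h2 := hq₁ N w' (fun _ => 0) hlen (fun _ => Nat.zero_le _) (.push (some .memory) Γ'.blank) 1
    (fun j => contents w' (List.replicate j Γ'.blank) [] [] [] fun _ => 0)
    (fun j _ => ⟨rfl, rfl, fun _ => rfl⟩)
    fun j _ => (Cmd.Spec.push _ _ _).congr_right (by simp [List.replicate_succ])
  rw [ht] at h2
  have h3 := hq₂ N w' (List.replicate N Γ'.blank) [] (fun _ => 0) hlen (by simp)
    (fun _ => Nat.zero_le _)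
  have h4 := hq₃ N w' m [] (fun _ => 0) hlen hml.le (fun _ => Nat.zero_le _)
  -- Only the answer may remain; the variable stacks are empty already, since they represent zeros.
  have h5 := (Cmd.Spec.clear .input (contents w' m [] []
    [truth (φ.Holds w' m fun _ => 0)] fun _ => 0)).mono (τ' := 2 * N + 1) (by simpa using hlen)
  rw [update_contents_input] at h5
  have h6 := (Cmd.Spec.clear .memory (contents [] m [] []
    [truth (φ.Holds w' m fun _ => 0)] fun _ => 0)).mono (τ' := 2 * N + 1) (by simp [hml])
  rw [update_contents_memory] at h6
  have h7 := (h1.seq (h2.seq (h3.seq (h4.seq (h5.seq h6))))) []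
  have hs : Cmd.withControl (contents w [] [] [] [] fun _ => 0) [] =
      update (fun _ => []) (some Stack.input) w := by
    funext k
    rcases k with _ | k
    · simp
    · cases k <;> simp
  have hs' : Cmd.withControl (contents [] [] [] [] [truth (φ.Holds w' m fun _ => 0)] fun _ => 0) []
      = update (fun _ => []) (some Stack.answer) [Γ'.bit (decide (w ∈ L))] := by
    funext k
    rcases k with _ | k
    · simp
    · have hφ : w ∈ L ↔ φ.Holds w' m fun _ => 0 := h w
      cases k <;> simp [truth, hφ]
  rw [hs, hs'] at h7
  refine h7.mono ?_
  simp only [Polynomial.eval_add, Polynomial.eval_mul, Polynomial.eval_comp, Polynomial.eval_one,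
    Polynomial.eval_ofNat, hB]
  exact le_rfl

namespace Prog

theorem count_set {α : Type*} [DecidableEq α] (m : List α) (i : ℕ) (a : α) :
    m.set i a = m ∨ m.count a < (m.set i a).count a := by
  by_cases hi : i < m.length
  · by_cases ha : m[i] = a
    · left; rw [← ha]; simp
    · right
      rw [List.count_set hi]
      simp [ha]
  · left; exact List.set_eq_of_length_le (by omega)

/-- A program that changes the memory increases the number of marked cells. -/
theorem run_eq_or_count_lt (w : List Γ') (p : Prog) (e : Fin 12 → ℕ) (m : List Γ') :
    p.run w e m = m ∨ m.count Cmd.one < (p.run w e m).count Cmd.one := by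
  induction p generalizing e m with
  | set t => exact count_set _ _ _
  | cond φ p ih =>
    rw [run]
    split_ifs
    · exact ih e m
    · exact .inl rfl
  | each v p ih =>
    rw [run]
    generalize List.range w.length = l
    induction l generalizing m with
    | nil => exact .inl rfl
    | cons k l ihl =>
      rw [List.foldl_cons]
      rcases ih (update e v k) m with h | h
      · rw [h]; exact ihl m
      · rcases ihl (p.run w (update e v k) m) with h' | h'
        · rw [h']; exact .inr h
        · exact .inr (h.trans h')
  | times t p ih =>
    rw [run]
    generalize t.value w e = n
    induction n generalizing m with
    | zero => exact .inl rfl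
    | succ n ihn =>
      rw [iterate_succ_apply]
      rcases ih e m with h | h
      · rw [h]; exact ihn m
      · rcases ihn (p.run w e m) with h' | h'
        · rw [h']; exact .inr h
        · exact .inr (h.trans h')

/-- The number of marks never decreases along the loop. If the loop as a whole changes nothing, then
its first round adds no mark and hence changes nothing, and the same applies to the remaining
rounds. -/
theorem run_eq_of_each {w : List Γ'} {p : Prog} {e : Fin 12 → ℕ} {v : Fin 12} {m : List Γ'}
    (h : (each v p).run w e m = m) {k : ℕ} (hk : k < w.length) :
    p.run w (update e v k) m = m := by
  rw [run] at h
  have key : ∀ (l : List ℕ) (m' : List Γ'),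
      m'.count Cmd.one ≤ (l.foldl (fun m k => p.run w (update e v k) m) m').count Cmd.one := by
    intro l
    induction l with
    | nil => intro m'; rfl
    | cons j l ih =>
      intro m'
      refine le_trans ?_ (ih _)
      rcases p.run_eq_or_count_lt w (update e v j) m' with h | h
      · exact (congrArg (List.count Cmd.one) h).ge
      · exact h.le
  have key' : ∀ l : List ℕ, l.foldl (fun m k => p.run w (update e v k) m) m = m →
      ∀ j ∈ l, p.run w (update e v j) m = m := by
    intro l
    induction l with
    | nil => simp
    | cons j l ih =>
      intro hl i hi
      rw [List.foldl_cons] at hl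
      have hj : p.run w (update e v j) m = m := by
        rcases p.run_eq_or_count_lt w (update e v j) m with h | h
        · exact h
        · have := key l (p.run w (update e v j) m)
          rw [hl] at this
          omega
      rcases List.mem_cons.1 hi with rfl | hi
      · exact hj
      · rw [hj] at hl
        exact ih hl i hi
  exact key' _ h k (List.mem_range.2 hk)

/-- Repeating a program as often as there are memory cells leads to a fixed point. -/
theorem run_run_times {w : List Γ'} {p : Prog} {e : Fin 12 → ℕ} {t : Term} {m : List Γ'}
    (h : m.length ≤ t.value w e) :
    p.run w e ((times t p).run w e m) = (times t p).run w e m := by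
  simp only [run]
  by_contra hne
  -- An iterate that is a fixed point stays so forever; as the last one is not fixed, no earlier one
  -- is.
  have key : ∀ n ≤ t.value w e, p.run w e ((p.run w e)^[n] m) ≠ (p.run w e)^[n] m := by
    intro n hn heq
    apply hne
    obtain ⟨j, hj⟩ := Nat.exists_eq_add_of_le' hn
    rw [hj, iterate_add_apply, iterate_fixed heq, heq]
  -- Every application therefore adds a mark, and one application more than there are cells produces
  -- too many marks.
  have key' : ∀ n ≤ t.value w e + 1, n ≤ ((p.run w e)^[n] m).count Cmd.one := by
    intro n
    induction n with
    | zero => simp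
    | succ n ih =>
      intro hn
      have h1 := ih (by omega)
      rw [iterate_succ_apply']
      rcases p.run_eq_or_count_lt w e ((p.run w e)^[n] m) with h' | h'
      · exact absurd h' (key n (by omega))
      · omega
  have h1 := key' _ le_rfl
  have h2 : ((p.run w e)^[t.value w e + 1] m).count Cmd.one ≤ m.length := by
    rw [← iterate_length _ (length_run w p e) (t.value w e + 1) m]
    exact List.count_le_length
  omega

theorem run_each_induction {w : List Γ'} {p : Prog} {e : Fin 12 → ℕ} {v : Fin 12}
    (I : List Γ' → Prop) (h : ∀ k < w.length, ∀ m, I m → I (p.run w (update e v k) m))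
    (m : List Γ') (hm : I m) : I ((each v p).run w e m) := by
  rw [run]
  have : ∀ l : List ℕ, (∀ k ∈ l, k < w.length) → ∀ m, I m →
      I (l.foldl (fun m k => p.run w (update e v k) m) m) := by
    intro l
    induction l with
    | nil => exact fun _ m hm => hm
    | cons k l ih =>
      intro hl m hm
      rw [List.foldl_cons]
      exact ih (fun j hj => hl j (by simp [hj])) _ (h k (hl k (by simp)) m hm)
  exact this _ (fun k hk => List.mem_range.1 hk) m hm

theorem run_times_induction {w : List Γ'} {p : Prog} {e : Fin 12 → ℕ} {t : Term}
    (I : List Γ' → Prop) (h : ∀ m, I m → I (p.run w e m)) (m : List Γ') (hm : I m) :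
    I ((times t p).run w e m) := by
  rw [run]
  generalize t.value w e = n
  induction n with
  | zero => exact hm
  | succ n ih => rw [iterate_succ_apply']; exact h _ ih

end Prog

end SinglePlateaued

namespace SinglePlateaued

/-! ### Single-plateaued profiles and pairs of candidates -/

section Combinatorics

variable {C : Type*} (V : Multiset (WeakOrder C))

/-- Some vote forces `d` not to lie between `e` and `c` on an axis. -/
def Forces (e d c : C) : Prop :=
  ∃ v ∈ V, v.pref e d ∧ v.pref c d ∧ d ∉ v.top ∧ e ≠ d ∧ c ≠ d

/-- Two ordered pairs of candidates that have the same orientation on every axis for `V`, as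
forced by a single vote. -/
inductive Link : C × C → C × C → Prop
  | left {e d c : C} : Forces V e d c → Link (e, d) (c, d)
  | right {e d c : C} : Forces V e d c → Link (d, e) (d, c)

variable {V}

theorem WeakOrder.pref_refl (v : WeakOrder C) (a : C) : v.pref a a :=
  (v.total a a).elim id id

/-- By totality any two candidates have one that is at least as good as both; a finite directed
family has an upper bound. -/
theorem WeakOrder.exists_mem_top [Finite C] [Nonempty C] (v : WeakOrder C) : ∃ y, y ∈ v.top := by
  have : IsTrans C fun a b => v.pref b a := ⟨fun a b c h h' => v.trans _ _ _ h' h⟩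
  have hd : Directed (fun a b => v.pref b a) (id : C → C) := fun a b => by
    rcases v.total a b with h | h
    · exact ⟨a, v.pref_refl a, h⟩
    · exact ⟨b, h, v.pref_refl b⟩
  obtain ⟨y, hy⟩ := hd.finite_le (id : C → C)
  exact ⟨y, fun d => hy d⟩

theorem Forces.symm {e d c : C} (h : Forces V e d c) : Forces V c d e :=
  let ⟨v, hv, h1, h2, h3, h4, h5⟩ := h
  ⟨v, hv, h2, h1, h3, h5, h4⟩

theorem Link.symm {x y : C × C} (h : Link V x y) : Link V y x := by
  cases h with
  | left h => exact .left h.symm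
  | right h => exact .right h.symm

/-- As `d` is not top, it lies in `X` or in `Z`. In `X`, a candidate at least as good as `d` is
never to the left of `d`; in `Z`, such a candidate other than `d` is always to the left. Either way
`e` and `c` are on the same side. -/
theorem WeakOrder.IsSinglePlateauedOn.lt_iff {v : WeakOrder C} {A : LinearOrder C}
    (h : v.IsSinglePlateauedOn A) {e d c : C} (hed : v.pref e d) (hcd : v.pref c d)
    (hd : d ∉ v.top) (he : e ≠ d) (hc : c ≠ d) : A.lt e d ↔ A.lt c d := by
  obtain ⟨X, Y, Z, hcov, hXY, hYZ, hXZ, rfl, hX, hZ⟩ := h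
  have mem : ∀ x : C, x ∈ X ∨ x ∈ v.top ∨ x ∈ Z := fun x => by
    have : x ∈ X ∪ v.top ∪ Z := hcov ▸ Set.mem_univ x
    simpa [or_assoc] using this
  have asymm : ∀ x y : C, A.lt x y → ¬ A.lt y x := fun x y => lt_asymm
  have tri : ∀ x y : C, x ≠ y → A.lt x y ∨ A.lt y x := fun x y => lt_or_gt_of_ne
  rcases mem d with hdX | hdY | hdZ
  · have key : ∀ x, v.pref x d → ¬ A.lt x d := fun x hx hlt => by
      rcases mem x with h | h | h
      · exact (hX x h d hdX hlt).2 hx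
      · exact asymm _ _ hlt (hXY d hdX x h)
      · exact asymm _ _ hlt (hXZ d hdX x h)
    exact iff_of_false (key e hed) (key c hcd)
  · exact absurd hdY hd
  · have key : ∀ x, v.pref x d → x ≠ d → A.lt x d := fun x hx hne => by
      rcases tri x d hne with hlt | hlt
      · exact hlt
      · rcases mem x with h | h | h
        · exact hXZ x h d hdZ
        · exact hYZ x h d hdZ
        · exact absurd hx (hZ d hdZ x h hlt).2
    exact iff_of_true (key e hed he) (key c hcd hc)

/-- Orientation on a common axis is invariant along links, whereas `(a, b)` and `(b, a)` have
opposite orientations. -/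
theorem IsSinglePlateaued.not_reaches (h : IsSinglePlateaued V) {a b : C} (hab : a ≠ b) :
    ¬ Relation.ReflTransGen (Link V) (a, b) (b, a) := by
  obtain ⟨A, hA⟩ := h
  have key : ∀ x y : C × C, Link V x y → (A.lt x.1 x.2 ↔ A.lt y.1 y.2) := by
    intro x y h
    have aux : ∀ e d : C, e ≠ d → (A.lt d e ↔ ¬ A.lt e d) := fun e d hne =>
      ⟨fun h h' => lt_asymm h h', fun h => (lt_or_gt_of_ne hne).resolve_left h⟩
    cases h with
    | left h =>
      obtain ⟨v, hv, h1, h2, h3, h4, h5⟩ := h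
      exact (hA v hv).lt_iff h1 h2 h3 h4 h5
    | right h =>
      obtain ⟨v, hv, h1, h2, h3, h4, h5⟩ := h
      simp only
      rw [aux _ _ h4, aux _ _ h5, (hA v hv).lt_iff h1 h2 h3 h4 h5]
  have key' : ∀ x y : C × C, Relation.ReflTransGen (Link V) x y →
      (A.lt x.1 x.2 ↔ A.lt y.1 y.2) := by
    intro x y h
    induction h with
    | refl => rfl
    | tail _ h ih => exact ih.trans (key _ _ h)
  intro hr
  have h1 : A.lt a b ↔ A.lt b a := key' _ _ hr
  have asymm : ∀ x y : C, A.lt x y → ¬ A.lt y x := fun x y => lt_asymm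
  have tri : A.lt a b ∨ A.lt b a := lt_or_gt_of_ne hab
  rcases tri with h | h
  · exact asymm _ _ h (h1.1 h)
  · exact asymm _ _ h (h1.2 h)

/-- An orientation of the pairs of candidates that respects the links is transitive on triples that
are not top everywhere, and thus gives rise to an axis. -/
theorem isSinglePlateaued_of_orientation [Finite C] (lt : C → C → Prop)
    (asymm : ∀ a b, lt a b → ¬ lt b a) (tri : ∀ a b, a ≠ b → lt a b ∨ lt b a)
    (hl : ∀ e d c, Forces V e d c → (lt e d ↔ lt c d))
    (htop : ∀ a b c, (∀ v ∈ V, a ∈ v.top) → (∀ v ∈ V, b ∈ v.top) → (∀ v ∈ V, c ∈ v.top) →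
      lt a b → lt b c → lt a c) : IsSinglePlateaued V := by
  classical
  have irrefl : ∀ a, ¬ lt a a := fun a h => asymm a a h h
  have ne : ∀ a b, lt a b → a ≠ b := fun a b h hab => irrefl a (by rw [hab] at h ⊢; exact h)
  have hr : ∀ e d c, Forces V e d c → (lt d e ↔ lt d c) := by
    intro e d c h
    have h' := h
    obtain ⟨v, _, _, _, _, h4, h5⟩ := h'
    have aux : ∀ e, e ≠ d → (lt d e ↔ ¬ lt e d) := fun e hne =>
      ⟨fun h h' => asymm _ _ h h', fun h => (tri _ _ hne).resolve_left h⟩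
    rw [aux e h4, aux c h5, hl e d c h]
  have trans : ∀ a b c, lt a b → lt b c → lt a c := by
    intro a b c hab hbc
    have nab := ne _ _ hab
    have nbc := ne _ _ hbc
    have nac : a ≠ c := fun h => asymm _ _ hab (h ▸ hbc)
    by_cases hT : ∃ v ∈ V, ∃ x, (x = a ∨ x = b ∨ x = c) ∧ x ∉ v.top
    · obtain ⟨v, hv, x, hx, hxt⟩ := hT
      have low : ∀ d, v.pref x d → d ∉ v.top := fun d hd ht =>
        hxt fun y => v.trans _ _ _ hd (ht y)
      -- One of the three is weakly worst for `v`. It is weakly below `x`, hence not top, and so the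
      -- other two are on the same side of it. If it is `a` or `c`, this gives `lt a c`; if it is
      -- `b`, it contradicts `lt a b` and `lt b c`.
      have worst : (v.pref b a ∧ v.pref c a) ∨ (v.pref a b ∧ v.pref c b) ∨
          (v.pref a c ∧ v.pref b c) := by
        rcases v.total a b with h1 | h1 <;> rcases v.total b c with h2 | h2
        · exact .inr (.inr ⟨v.trans _ _ _ h1 h2, h2⟩)
        · exact .inr (.inl ⟨h1, h2⟩)
        · rcases v.total a c with h3 | h3
          · exact .inr (.inr ⟨h3, h2⟩)
          · exact .inl ⟨h1, h3⟩
        · exact .inl ⟨h1, v.trans _ _ _ h2 h1⟩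
      have hxd : ∀ d, (d = a ∨ v.pref a d) → (d = b ∨ v.pref b d) → (d = c ∨ v.pref c d) →
          v.pref x d := by
        intro d h1 h2 h3
        rcases hx with rfl | rfl | rfl
        · exact h1.elim (fun h => h ▸ v.pref_refl _) id
        · exact h2.elim (fun h => h ▸ v.pref_refl _) id
        · exact h3.elim (fun h => h ▸ v.pref_refl _) id
      rcases worst with ⟨h1, h2⟩ | ⟨h1, h2⟩ | ⟨h1, h2⟩
      · exact (hr b a c ⟨v, hv, h1, h2, low a (hxd a (.inl rfl) (.inr h1) (.inr h2)), nab.symm,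
          nac.symm⟩).1 hab
      · exact absurd ((hl a b c ⟨v, hv, h1, h2, low b (hxd b (.inr h1) (.inl rfl) (.inr h2)), nab,
          nbc.symm⟩).1 hab) (asymm _ _ hbc)
      · exact (hl a c b ⟨v, hv, h1, h2, low c (hxd c (.inr h1) (.inr h2) (.inl rfl)), nac,
          nbc⟩).2 hbc
    · push Not at hT
      exact htop a b c (fun v hv => hT v hv a (by simp)) (fun v hv => hT v hv b (by simp))
        (fun v hv => hT v hv c (by simp)) hab hbc
  have : IsStrictTotalOrder C lt :=
    { irrefl := irrefl
      trans := trans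
      trichotomous := fun a b h h' => by
        by_contra hne
        exact (tri a b hne).elim h h' }
  refine ⟨linearOrderOfSTO lt, fun v hv => ?_⟩
  refine ⟨{x | x ∉ v.top ∧ ∀ y ∈ v.top, lt x y}, v.top, {x | x ∉ v.top ∧ ∀ y ∈ v.top, lt y x},
    ?_, fun x hx y hy => hx.2 y hy, fun y hy z hz => hz.2 y hy, ?_, rfl, ?_, ?_⟩
  · refine Set.eq_univ_of_forall fun d => ?_
    by_cases hd : d ∈ v.top
    · exact .inl (.inr hd)
    · have hne : ∀ y ∈ v.top, y ≠ d := fun y hy h => hd (h ▸ hy)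
      by_cases hall : ∀ y ∈ v.top, lt d y
      · exact .inl (.inl ⟨hd, hall⟩)
      · push Not at hall
        obtain ⟨y, hy, hlt⟩ := hall
        -- Two top candidates force `d` not to lie between them, so being to the right of one of
        -- them means being to the right of all.
        have hyd := (tri y d (hne y hy)).resolve_right hlt
        exact .inr ⟨hd, fun y' hy' =>
          (hl y d y' ⟨v, hv, hy d, hy' d, hd, hne y hy, hne y' hy'⟩).1 hyd⟩
  · intro x hx z hz
    have : Nonempty C := ⟨x⟩
    obtain ⟨y, hy⟩ := v.exists_mem_top
    exact trans _ _ _ (hx.2 y hy) (hz.2 y hy)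
  · intro a ha b hb hab
    have hab' : lt a b := hab
    -- Otherwise `a` and a top candidate `y` are both at least as good as `b`, hence on the same
    -- side of `b`; but `a` is to its left and `y` to its right. The decreasing segment is treated
    -- symmetrically.
    have hnot : ¬ v.pref a b := fun hp => by
      have : Nonempty C := ⟨a⟩
      obtain ⟨y, hy⟩ := v.exists_mem_top
      have hyb : lt y b :=
        (hl a b y ⟨v, hv, hp, hy b, hb.1, ne _ _ hab', fun h => hb.1 (h ▸ hy)⟩).1 hab'
      exact asymm _ _ hyb (hb.2 y hy)
    exact ⟨(v.total a b).resolve_left hnot, hnot⟩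
  · intro a ha b hb hab
    have hab' : lt a b := hab
    have hnot : ¬ v.pref b a := fun hp => by
      have : Nonempty C := ⟨a⟩
      obtain ⟨y, hy⟩ := v.exists_mem_top
      have hay : lt a y := (hr b a y ⟨v, hv, hp, hy a, ha.1, (ne _ _ hab').symm,
        fun h => ha.1 (h ▸ hy)⟩).1 hab'
      exact asymm _ _ hay (ha.2 y hy)
    exact ⟨(v.total a b).resolve_right hnot, hnot⟩

/-- A profile is single-plateaued if and only if no pair of candidates is linked to its reverse. -/
theorem isSinglePlateaued_iff [Finite C] : IsSinglePlateaued V ↔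
    ∀ a b, a ≠ b → ¬ Relation.ReflTransGen (Link V) (a, b) (b, a) := by
  classical
  refine ⟨fun h a b hab => h.not_reaches hab, fun h => ?_⟩
  have hsymm : ∀ x y, Relation.ReflTransGen (Link V) x y → Relation.ReflTransGen (Link V) y x :=
    fun x y h => by
      induction h with
      | refl => exact .refl
      | tail _ h ih => exact .head h.symm ih
  -- Links are symmetric, so reachability is an equivalence relation.
  let S : Setoid (C × C) := ⟨Relation.ReflTransGen (Link V),
    fun x => .refl, fun {x y} h => hsymm x y h, fun h h' => h.trans h'⟩
  let r : Quotient S → Quotient S → Prop := WellOrderingRel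
  let r' : C → C → Prop := WellOrderingRel
  let q : C × C → Quotient S := Quotient.mk S
  let T : C → Prop := fun c => ∀ v ∈ V, c ∈ v.top
  have hq : ∀ x y, Link V x y → q x = q y := fun x y h => Quotient.sound (.single h)
  have hne : ∀ a b, a ≠ b → q (a, b) ≠ q (b, a) := fun a b hab heq =>
    h a b hab (Quotient.exact heq)
  -- A link that preserves the class of `(e, d)` has a twin that preserves the class of `(d, e)`, so
  -- comparing these classes respects the links. It is a strict choice, because the two classes
  -- differ by hypothesis. Pairs that are top in every vote take part in no link and are compared by
  -- `r'`, which is transitive.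
  refine isSinglePlateaued_of_orientation
    (fun a b => if T a ∧ T b then r' a b else r (q (a, b)) (q (b, a))) ?_ ?_ ?_ ?_
  · intro a b hab hba
    have hc : T b ∧ T a ↔ T a ∧ T b := and_comm
    simp only [hc] at hba
    split_ifs at hab hba
    · exact asymm_of r' hab hba
    · exact asymm_of r hab hba
  · intro a b hab
    have hc : T b ∧ T a ↔ T a ∧ T b := and_comm
    simp only [hc]
    split_ifs
    · exact (trichotomous_of r' a b).imp_right fun h => h.resolve_left hab
    · exact (trichotomous_of r _ _).imp_right fun h => h.resolve_left (hne a b hab)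
  · intro e d c hf
    have hd : ¬ T d := fun hd => by
      obtain ⟨v, hv, _, _, h3, _⟩ := hf
      exact h3 (hd v hv)
    simp only [hd, and_false, if_false]
    rw [hq _ _ (.left hf), hq _ _ (.right hf)]
  · intro a b c ha hb hc hab hbc
    have ha' : T a := ha
    have hb' : T b := hb
    have hc' : T c := hc
    simp only [ha', hb', hc', and_self, if_true] at hab hbc ⊢
    exact trans_of r' hab hbc

end Combinatorics

end SinglePlateaued

namespace SinglePlateaued

open Computability

/-! ### Codes of profiles -/

section Codes

/-- The word `w` ends before the position `p`, or has a comma there. -/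
def EndsAt (w : List Γ') (p : ℕ) : Prop := w[p]? = none ∨ w[p]? = some Γ'.comma

/-- The word `w` begins with the unary code of `m`. -/
def Lead (w : List Γ') (m : ℕ) : Prop := (∀ i < m, w[i]? = some (Γ'.bit true)) ∧ EndsAt w m

/-- The relation that is written in `w` after the position `p`, in rows of length `m`. -/
def Row (w : List Γ') (m p a b : ℕ) : Prop := w[p + 1 + (a * m + b)]? = some (Γ'.bit true)

/-- Every comma of `w` is followed by the code of a weak order on `m` candidates. -/
def Valid (w : List Γ') (m : ℕ) : Prop :=
  ∀ p, w[p]? = some Γ'.comma →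
    (∀ a < m, ∀ b < m, ∃ β, w[p + 1 + (a * m + b)]? = some (Γ'.bit β)) ∧
    EndsAt w (p + 1 + m * m) ∧
    (∀ a < m, ∀ b < m, Row w m p a b ∨ Row w m p b a) ∧
    (∀ a < m, ∀ b < m, ∀ c < m, Row w m p a b → Row w m p b c → Row w m p a c)

/-- The code of a list of weak orders, without the number of candidates. -/
noncomputable def encodeOrders {m : ℕ} (V : List (WeakOrder (Fin m))) : List Γ' :=
  V.flatMap fun v => Γ'.comma :: encodeOrder v

variable {m : ℕ}

/-- At the smaller number the word would have both a one and an end or comma. -/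
theorem Lead.unique {w : List Γ'} {m m' : ℕ} (h : Lead w m) (h' : Lead w m') : m = m' := by
  have key : ∀ {m m' : ℕ}, Lead w m → Lead w m' → ¬ m < m' := by
    rintro m m' ⟨_, h | h⟩ ⟨h', _⟩ hlt <;> simp [h' m hlt] at h
  have := key h h'
  have := key h' h
  omega

theorem getElem?_flatMap {α β : Type*} (f : α → List β) {k : ℕ} (hf : ∀ a, (f a).length = k)
    (l : List α) (i : ℕ) {j : ℕ} (hj : j < k) :
    (l.flatMap f)[i * k + j]? = l[i]?.bind fun a => (f a)[j]? := by
  induction l generalizing i with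
  | nil => simp
  | cons a l ih =>
    rw [List.flatMap_cons]
    cases i with
    | zero => rw [List.getElem?_append_left (by rw [hf]; omega)]; simp
    | succ i =>
      rw [List.getElem?_append_right (by rw [hf, add_mul]; omega), hf,
        show (i + 1) * k + j - k = i * k + j by rw [add_mul]; omega, ih]
      simp

theorem mul_add_lt {m a b : ℕ} (ha : a < m) (hb : b < m) : a * m + b < m * m := by
  have := Nat.mul_le_mul_right m (show a + 1 ≤ m from ha)
  rw [add_mul] at this
  omega

open Classical in
theorem getElem?_encodeOrder (v : WeakOrder (Fin m)) (a b : Fin m) :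
    (encodeOrder v)[(a : ℕ) * m + b]? = some (Γ'.bit (decide (v.pref a b))) := by
  rw [encodeOrder, getElem?_flatMap _ (by simp) _ _ b.2]
  simp

theorem eq_bit_of_mem_encodeOrder {v : WeakOrder (Fin m)} {x : Γ'} (h : x ∈ encodeOrder v) :
    ∃ β, x = Γ'.bit β := by
  simp only [encodeOrder, List.mem_flatMap, List.mem_map] at h
  obtain ⟨a, _, b, _, rfl⟩ := h
  exact ⟨_, rfl⟩

theorem encodeOrders_cons (v : WeakOrder (Fin m)) (V : List (WeakOrder (Fin m))) :
    encodeOrders (v :: V) = Γ'.comma :: (encodeOrder v ++ encodeOrders V) := rfl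

theorem getElem?_encodeOrders_add (v : WeakOrder (Fin m)) (V : List (WeakOrder (Fin m))) (q : ℕ) :
    (encodeOrders (v :: V))[m * m + 1 + q]? = (encodeOrders V)[q]? := by
  rw [encodeOrders_cons, show m * m + 1 + q = m * m + q + 1 by ring, List.getElem?_cons_succ,
    List.getElem?_append_right (by rw [length_encodeOrder]; omega), length_encodeOrder]
  simp

open Classical in
theorem getElem?_encodeOrders_head (v : WeakOrder (Fin m)) (V : List (WeakOrder (Fin m)))
    (a b : Fin m) :
    (encodeOrders (v :: V))[0 + 1 + ((a : ℕ) * m + b)]? =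
      some (Γ'.bit (decide (v.pref a b))) := by
  rw [encodeOrders_cons, show 0 + 1 + ((a : ℕ) * m + b) = (a : ℕ) * m + b + 1 by ring,
    List.getElem?_cons_succ, List.getElem?_append_left
      (by rw [length_encodeOrder]; exact mul_add_lt a.2 b.2), getElem?_encodeOrder]

theorem endsAt_encodeOrders (V : List (WeakOrder (Fin m))) : EndsAt (encodeOrders V) 0 := by
  cases V with
  | nil => exact .inl rfl
  | cons v V => exact .inr rfl

open Classical in
/-- The word `w` contains the code of the weak order `v` after the position `p`. -/
def OrderAt (w : List Γ') (p : ℕ) (v : WeakOrder (Fin m)) : Prop :=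
  ∀ a b : Fin m, w[p + 1 + ((a : ℕ) * m + b)]? = some (Γ'.bit (decide (v.pref a b)))

theorem OrderAt.row_iff {w : List Γ'} {p : ℕ} {v : WeakOrder (Fin m)} (h : OrderAt w p v)
    (a b : Fin m) : Row w m p a b ↔ v.pref a b := by
  rw [Row, h a b]
  simp

/-- The matrices consist of bits, so a comma can only be the start of a block: position `0`, or a
position in the code of the remaining votes. -/
theorem exists_orderAt_encodeOrders (V : List (WeakOrder (Fin m))) (p : ℕ)
    (h : (encodeOrders V)[p]? = some Γ'.comma) :
    ∃ v ∈ V, OrderAt (encodeOrders V) p v ∧ EndsAt (encodeOrders V) (p + 1 + m * m) := by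
  induction V generalizing p with
  | nil => simp [encodeOrders] at h
  | cons v V ih =>
    rcases Nat.lt_or_ge p (m * m + 1) with hp | hp
    · rcases p with _ | p
      · refine ⟨v, by simp, getElem?_encodeOrders_head v V, ?_⟩
        rw [EndsAt, show 0 + 1 + m * m = m * m + 1 + 0 by ring, getElem?_encodeOrders_add]
        exact endsAt_encodeOrders V
      · rw [encodeOrders_cons, List.getElem?_cons_succ, List.getElem?_append_left
          (by rw [length_encodeOrder]; omega)] at h
        obtain ⟨β, hβ⟩ := eq_bit_of_mem_encodeOrder (List.mem_of_getElem? h)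
        cases hβ
    · obtain ⟨q, rfl⟩ := Nat.exists_eq_add_of_le hp
      rw [getElem?_encodeOrders_add] at h
      obtain ⟨v', hv', h1, h2⟩ := ih q h
      refine ⟨v', by simp [hv'], fun a b => ?_, ?_⟩
      · rw [← h1 a b, ← getElem?_encodeOrders_add v V]
        congr 1
        ring
      · rw [EndsAt, show m * m + 1 + q + 1 + m * m = m * m + 1 + (q + 1 + m * m) by ring,
          getElem?_encodeOrders_add]
        exact h2

theorem exists_comma_encodeOrders (V : List (WeakOrder (Fin m))) (v : WeakOrder (Fin m))
    (hv : v ∈ V) :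
    ∃ p, (encodeOrders V)[p]? = some Γ'.comma ∧ OrderAt (encodeOrders V) p v := by
  induction V with
  | nil => simp at hv
  | cons v' V ih =>
    rcases List.mem_cons.1 hv with rfl | hv
    · exact ⟨0, rfl, getElem?_encodeOrders_head v V⟩
    · obtain ⟨p, h1, h2⟩ := ih hv
      refine ⟨m * m + 1 + p, by rw [getElem?_encodeOrders_add, h1], fun a b => ?_⟩
      rw [← h2 a b, ← getElem?_encodeOrders_add v' V]
      congr 1
      ring

/-- The word `w` consists of the number `m` and of the weak orders in `V`. -/
structure Represents (w : List Γ') (V : List (WeakOrder (Fin m))) : Prop where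
  lead : Lead w m
  exists_order : ∀ p, w[p]? = some Γ'.comma → ∃ v ∈ V, OrderAt w p v ∧ EndsAt w (p + 1 + m * m)
  exists_comma : ∀ v ∈ V, ∃ p, w[p]? = some Γ'.comma ∧ OrderAt w p v

theorem getElem?_encodeProfile_add (V : List (WeakOrder (Fin m))) (q : ℕ) :
    (encodeProfile V)[m + q]? = (encodeOrders V)[q]? := by
  rw [encodeProfile, List.getElem?_append_right (by simp)]
  simp [encodeOrders]

theorem represents_encodeProfile (V : List (WeakOrder (Fin m))) :
    Represents (encodeProfile V) V where
  lead := by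
    refine ⟨fun i hi => ?_, ?_⟩
    · rw [encodeProfile, List.getElem?_append_left (by simpa using hi)]
      simp [hi]
    · have := getElem?_encodeProfile_add V 0
      rw [add_zero] at this
      rw [EndsAt, this]
      exact endsAt_encodeOrders V
  exists_order p hp := by
    rcases Nat.lt_or_ge p m with h | h
    · rw [encodeProfile, List.getElem?_append_left (by simpa using h)] at hp
      simp [h] at hp
    · obtain ⟨q, rfl⟩ := Nat.exists_eq_add_of_le h
      rw [getElem?_encodeProfile_add] at hp
      obtain ⟨v, hv, h1, h2⟩ := exists_orderAt_encodeOrders V q hp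
      refine ⟨v, hv, fun a b => ?_, ?_⟩
      · rw [← h1 a b, ← getElem?_encodeProfile_add]
        congr 1
        ring
      · rw [EndsAt, show m + q + 1 + m * m = m + (q + 1 + m * m) by ring,
          getElem?_encodeProfile_add]
        exact h2
  exists_comma v hv := by
    obtain ⟨p, h1, h2⟩ := exists_comma_encodeOrders V v hv
    refine ⟨m + p, by rw [getElem?_encodeProfile_add, h1], fun a b => ?_⟩
    rw [← h2 a b, ← getElem?_encodeProfile_add]
    congr 1
    ring

theorem Represents.valid {w : List Γ'} {V : List (WeakOrder (Fin m))} (h : Represents w V) :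
    Valid w m := by
  intro p hp
  obtain ⟨v, _, h1, h2⟩ := h.exists_order p hp
  refine ⟨fun a ha b hb => ⟨_, h1 ⟨a, ha⟩ ⟨b, hb⟩⟩, h2, fun a ha b hb => ?_,
    fun a ha b hb c hc hab hbc => ?_⟩
  · exact (v.total ⟨a, ha⟩ ⟨b, hb⟩).imp (h1.row_iff ⟨a, ha⟩ ⟨b, hb⟩).2
      (h1.row_iff ⟨b, hb⟩ ⟨a, ha⟩).2
  · exact (h1.row_iff ⟨a, ha⟩ ⟨c, hc⟩).2 (v.trans _ _ _ ((h1.row_iff ⟨a, ha⟩ ⟨b, hb⟩).1 hab)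
      ((h1.row_iff ⟨b, hb⟩ ⟨c, hc⟩).1 hbc))

theorem Valid.drop {w : List Γ'} (h : Valid w m) (n : ℕ) : Valid (w.drop n) m := by
  intro p hp
  have aux : ∀ q, (w.drop n)[p + 1 + q]? = w[n + p + 1 + q]? := fun q => by
    rw [List.getElem?_drop]; congr 1; ring
  rw [List.getElem?_drop] at hp
  have := h (n + p) hp
  simpa only [Row, EndsAt, aux] using this

/-- Converse to `Represents.valid`. A nonempty word starts with a comma; the next `m * m` symbols
are the matrix of a weak order, and what remains is empty or starts with a comma and is again valid,
so that blocks can be split off one by one. -/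
theorem exists_eq_encodeOrders (u : List Γ') (h0 : EndsAt u 0) (h : Valid u m) :
    ∃ V : List (WeakOrder (Fin m)), u = encodeOrders V := by
  classical
  induction hn : u.length using Nat.strong_induction_on generalizing u with
  | _ n ih =>
    rcases u with _ | ⟨x, u⟩
    · exact ⟨[], rfl⟩
    · have hx : x = Γ'.comma := by simpa [EndsAt] using h0
      subst hx
      obtain ⟨h1, h2, h3, h4⟩ := h 0 rfl
      let v : WeakOrder (Fin m) :=
        { pref := fun a b => Row (Γ'.comma :: u) m 0 a b
          trans := fun a b c => h4 a a.2 b b.2 c c.2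
          total := fun a b => h3 a a.2 b b.2 }
      have aux : ∀ q, (Γ'.comma :: u)[0 + 1 + q]? = u[q]? := fun q => by
        rw [show 0 + 1 + q = q + 1 by ring, List.getElem?_cons_succ]
      have htake : u.take (m * m) = encodeOrder v := by
        refine List.ext_getElem? fun i => ?_
        rcases Nat.lt_or_ge i (m * m) with hi | hi
        -- The position `i` in the matrix belongs to row `i / m` and column `i % m`.
        · have hm : 0 < m := Nat.pos_of_ne_zero fun h0 => by simp [h0] at hi
          have hdiv : i / m < m := Nat.div_lt_of_lt_mul hi
          have hmod : i % m < m := Nat.mod_lt _ hm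
          have hi' : i / m * m + i % m = i := Nat.div_add_mod' i m
          have hv := getElem?_encodeOrder v ⟨i / m, hdiv⟩ ⟨i % m, hmod⟩
          obtain ⟨β, hβ⟩ := h1 _ hdiv _ hmod
          have hrow : v.pref ⟨i / m, hdiv⟩ ⟨i % m, hmod⟩ ↔ β = true := by
            change Row _ _ _ _ _ ↔ _
            rw [Row, hβ]
            simp
          simp only [hi', aux] at hv hβ
          rw [List.getElem?_take_of_lt hi, hβ, hv]
          cases β <;> simp_all
        · rw [List.getElem?_eq_none (by simp; omega),
            List.getElem?_eq_none (by rw [length_encodeOrder]; exact hi)]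
      have hdrop : Γ'.comma :: u = (Γ'.comma :: encodeOrder v) ++ u.drop (m * m) := by
        rw [← htake]; simp
      obtain ⟨V, hV⟩ := ih (u.drop (m * m)).length (by simp at hn ⊢; omega) (u.drop (m * m))
        (by simpa only [EndsAt, aux, List.getElem?_drop, add_zero] using h2)
        (by simpa [Nat.add_comm 1] using h.drop (1 + m * m)) rfl
      exact ⟨v :: V, by rw [hdrop, hV]; rfl⟩

theorem exists_eq_encodeProfile {w : List Γ'} (hl : Lead w m) (h : Valid w m) :
    ∃ V : List (WeakOrder (Fin m)), w = encodeProfile V := by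
  obtain ⟨V, hV⟩ := exists_eq_encodeOrders (w.drop m)
    (by simpa only [EndsAt, List.getElem?_drop, add_zero] using hl.2) (h.drop m)
  refine ⟨V, ?_⟩
  have : w.take m = List.replicate m (Γ'.bit true) := by
    refine List.ext_getElem? fun i => ?_
    rcases Nat.lt_or_ge i m with hi | hi
    · rw [List.getElem?_take_of_lt hi, hl.1 i hi]
      simp [hi]
    · rw [List.getElem?_eq_none (by simp; omega), List.getElem?_eq_none (by simpa using hi)]
  rw [encodeProfile, ← this]
  exact (List.take_append_drop m w).symm.trans (by rw [hV]; rfl)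

/-- The link between pairs of candidates, read off from a word. -/
inductive WordForces (w : List Γ') (e d c : ℕ) : Prop
  | intro (m p : ℕ) (lead : Lead w m) (he : e < m) (hd : d < m) (hc : c < m) (hed : e ≠ d)
    (hcd : c ≠ d) (comma : w[p]? = some Γ'.comma) (h : Row w m p e d) (h' : Row w m p c d)
    (top : ∃ f < m, ¬ Row w m p d f)

/-- Two pairs of candidates that are linked by a vote in a word. -/
inductive WordLink (w : List Γ') : ℕ × ℕ → ℕ × ℕ → Prop
  | left {e d c : ℕ} : WordForces w e d c → WordLink w (e, d) (c, d)
  | right {e d c : ℕ} : WordForces w e d c → WordLink w (d, e) (d, c)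

theorem Represents.wordForces_iff {w : List Γ'} {V : List (WeakOrder (Fin m))}
    (h : Represents w V) (e d c : Fin m) :
    WordForces w e d c ↔ Forces (V : Multiset (WeakOrder (Fin m))) e d c := by
  constructor
  · rintro ⟨m', p, lead, -, -, -, hed, hcd, hp, h1, h2, f, hf, h3⟩
    obtain rfl := h.lead.unique lead
    obtain ⟨v, hv, ho, -⟩ := h.exists_order p hp
    refine ⟨v, by simpa using hv, (ho.row_iff _ _).1 h1, (ho.row_iff _ _).1 h2, fun ht => ?_,
      fun h => hed (by rw [h]), fun h => hcd (by rw [h])⟩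
    exact h3 ((ho.row_iff d ⟨f, hf⟩).2 (ht _))
  · rintro ⟨v, hv, h1, h2, h3, h4, h5⟩
    obtain ⟨p, hp, ho⟩ := h.exists_comma v (by simpa using hv)
    obtain ⟨f, hf⟩ : ∃ f, ¬ v.pref d f := by simpa [WeakOrder.top] using h3
    exact ⟨m, p, h.lead, e.2, d.2, c.2, fun h => h4 (Fin.ext h), fun h => h5 (Fin.ext h), hp,
      (ho.row_iff _ _).2 h1, (ho.row_iff _ _).2 h2, f, f.2, fun h => hf ((ho.row_iff _ _).1 h)⟩

/-- `WordLink` relates arbitrary numbers and takes the number of candidates from the word. As that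
number is unique, a path that starts at candidates stays among candidates and is a path of links of
the profile. -/
theorem Represents.reaches_iff {w : List Γ'} {V : List (WeakOrder (Fin m))}
    (h : Represents w V) (a b c d : Fin m) :
    Relation.ReflTransGen (WordLink w) (a, b) (c, d) ↔
      Relation.ReflTransGen (Link (V : Multiset (WeakOrder (Fin m)))) (a, b) (c, d) := by
  constructor
  · intro hr
    have key : ∀ y : ℕ × ℕ, Relation.ReflTransGen (WordLink w) ((a : ℕ), (b : ℕ)) y →
        ∃ c d : Fin m, y = ((c : ℕ), (d : ℕ)) ∧
          Relation.ReflTransGen (Link (V : Multiset (WeakOrder (Fin m)))) (a, b) (c, d) := by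
      intro y hy
      induction hy with
      | refl => exact ⟨a, b, rfl, .refl⟩
      | tail _ hl ih =>
        obtain ⟨c', d', rfl, hr⟩ := ih
        generalize hx : ((c' : ℕ), (d' : ℕ)) = x at hl
        cases hl with
        | @left e d c hf =>
          obtain ⟨rfl, rfl⟩ := Prod.mk.inj hx
          have hf' := hf
          obtain ⟨m', p, lead, -, -, hc, -⟩ := hf'
          obtain rfl := h.lead.unique lead
          exact ⟨⟨c, hc⟩, d', rfl, hr.tail (.left ((h.wordForces_iff c' d' ⟨c, hc⟩).1 hf))⟩
        | @right e d c hf =>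
          obtain ⟨rfl, rfl⟩ := Prod.mk.inj hx
          have hf' := hf
          obtain ⟨m', p, lead, -, -, hc, -⟩ := hf'
          obtain rfl := h.lead.unique lead
          exact ⟨c', ⟨c, hc⟩, rfl, hr.tail (.right ((h.wordForces_iff d' c' ⟨c, hc⟩).1 hf))⟩
    obtain ⟨c', d', hcd, hr⟩ := key _ hr
    obtain ⟨hc, hd⟩ := Prod.mk.inj hcd
    rw [Fin.ext hc, Fin.ext hd]
    exact hr
  · intro hr
    refine Relation.ReflTransGen.lift (fun x : Fin m × Fin m => ((x.1 : ℕ), (x.2 : ℕ))) ?_ _ _ hr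
    intro x y hl
    cases hl with
    | left hf => exact .left ((h.wordForces_iff _ _ _).2 hf)
    | right hf => exact .right ((h.wordForces_iff _ _ _).2 hf)

/-- A word is the code of a single-plateaued profile if and only if it is a code in which no pair
of candidates is linked to its reverse. -/
theorem mem_singlePlateauedLanguage_iff (w : List Γ') : w ∈ singlePlateauedLanguage ↔
    ∃ m, Lead w m ∧ Valid w m ∧ ∀ a < m, ∀ b < m, a ≠ b →
      ¬ Relation.ReflTransGen (WordLink w) (a, b) (b, a) := by
  constructor
  · rintro ⟨m, V, rfl, hV⟩
    have h := represents_encodeProfile V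
    refine ⟨m, h.lead, h.valid, fun a ha b hb hab hr => ?_⟩
    exact isSinglePlateaued_iff.1 hV ⟨a, ha⟩ ⟨b, hb⟩ (fun h => hab (congrArg Fin.val h))
      ((h.reaches_iff ⟨a, ha⟩ ⟨b, hb⟩ ⟨b, hb⟩ ⟨a, ha⟩).1 hr)
  · rintro ⟨m, hl, hv, hr⟩
    obtain ⟨V, rfl⟩ := exists_eq_encodeProfile hl hv
    have h := represents_encodeProfile V
    refine ⟨m, V, rfl, isSinglePlateaued_iff.2 fun a b hab hr' => ?_⟩
    exact hr a a.2 b b.2 (fun h => hab (Fin.ext h)) ((h.reaches_iff a b b a).2 hr')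

end Codes

end SinglePlateaued

namespace SinglePlateaued

open Computability Turing Function

/-! ### Single-plateauedness by a formula -/

namespace Fm

/-- Disjunction. -/
def or (φ ψ : Fm) : Fm := neg (and (neg φ) (neg ψ))

/-- Implication. -/
def imp (φ ψ : Fm) : Fm := neg (and φ (neg ψ))

/-- The bounded existential quantifier. -/
def ex (v : Fin 12) (φ : Fm) : Fm := neg (all v (neg φ))

/-- Strict inequality of variables. -/
def lt (u v : Fin 12) : Fm := neg (le (.var v) (.var u))

/-- Equality of variables. -/
def eq (u v : Fin 12) : Fm := and (le (.var u) (.var v)) (le (.var v) (.var u))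

/-- Quantification over the numbers below the value of a variable. -/
def allBelow (v u : Fin 12) (φ : Fm) : Fm := all v (imp (lt v u) φ)

/-- A property of the symbol at some position of a word that is preceded by a blank. -/
def sym (t : Term) (P : Option Γ' → Prop) [DecidablePred P] : Fm :=
  inp (.add t .one) fun o => decide (P o)

variable {w m : List Γ'} {e : Fin 12 → ℕ}

@[simp] theorem holds_or (φ ψ : Fm) : (φ.or ψ).Holds w m e ↔ φ.Holds w m e ∨ ψ.Holds w m e := by
  simp only [or, Holds]; tauto

@[simp] theorem holds_imp (φ ψ : Fm) : (φ.imp ψ).Holds w m e ↔ (φ.Holds w m e → ψ.Holds w m e) := by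
  simp only [imp, Holds]; tauto

@[simp] theorem holds_and (φ ψ : Fm) :
    (φ.and ψ).Holds w m e ↔ φ.Holds w m e ∧ ψ.Holds w m e := Iff.rfl

@[simp] theorem holds_neg (φ : Fm) : φ.neg.Holds w m e ↔ ¬ φ.Holds w m e := Iff.rfl

@[simp] theorem holds_all (v : Fin 12) (φ : Fm) :
    (all v φ).Holds w m e ↔ ∀ k < w.length, φ.Holds w m (update e v k) := Iff.rfl

@[simp] theorem holds_mem (t : Term) :
    (mem t).Holds w m e ↔ m[t.value w e]? = some (Γ'.bit true) := Iff.rfl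

@[simp] theorem holds_ex (v : Fin 12) (φ : Fm) :
    (ex v φ).Holds w m e ↔ ∃ k < w.length, φ.Holds w m (update e v k) := by
  simp [ex, Holds]

@[simp] theorem holds_lt (u v : Fin 12) : (lt u v).Holds w m e ↔ e u < e v := by
  simp [lt, Holds, Term.value]

@[simp] theorem holds_eq (u v : Fin 12) : (eq u v).Holds w m e ↔ e u = e v := by
  simp only [eq, Holds, Term.value]; omega

/-- The quantifier runs up to `w.length` inclusive because of the blank, which covers all numbers
below `e u`. -/
theorem holds_allBelow {v u : Fin 12} (huv : u ≠ v) (φ : Fm) (hu : e u ≤ w.length) :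
    (allBelow v u φ).Holds (Γ'.blank :: w) m e ↔
      ∀ k < e u, φ.Holds (Γ'.blank :: w) m (update e v k) := by
  simp only [allBelow, holds_all, holds_imp, holds_lt, update_self, update_of_ne huv,
    List.length_cons]
  exact ⟨fun h k hk => h k (by omega) hk, fun h k _ hk => h k hk⟩

@[simp] theorem holds_sym (t : Term) (P : Option Γ' → Prop) [DecidablePred P] :
    (sym t P).Holds (Γ'.blank :: w) m e ↔ P w[t.value (Γ'.blank :: w) e]? :=
  decide_eq_true_iff

/-- The formula for the end of the word or a comma at a position. -/
def endsAt (t : Term) : Fm := sym t fun o => o = none ∨ o = some Γ'.comma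

@[simp] theorem holds_endsAt (t : Term) : (endsAt t).Holds (Γ'.blank :: w) m e ↔
    EndsAt w (t.value (Γ'.blank :: w) e) := by
  simp [endsAt, EndsAt]

/-- The formula for a comma at the position `p`. -/
def comma (p : Fin 12) : Fm := sym (.var p) (· = some Γ'.comma)

@[simp] theorem holds_comma (p : Fin 12) : (comma p).Holds (Γ'.blank :: w) m e ↔
    w[e p]? = some Γ'.comma := by
  simp [comma, Term.value]

/-- The position in the matrix after the position `5` of the entry in row `x` and column `y`; the
variable `4` stands for the number of rows. -/
def entryTerm (x y : Fin 12) : Term :=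
  .add (.add (.var 5) .one) (.add (.mul (.var x) (.var 4)) (.var y))

@[simp] theorem value_entryTerm (x y : Fin 12) :
    (entryTerm x y).value w e = e 5 + 1 + (e x * e 4 + e y) := rfl

/-- The formula for the relation that is written after the position `5`. -/
def row (x y : Fin 12) : Fm := sym (entryTerm x y) (· = some (Γ'.bit true))

@[simp] theorem holds_row (x y : Fin 12) : (row x y).Holds (Γ'.blank :: w) m e ↔
    Row w (e 4) (e 5) (e x) (e y) := by
  simp [row, Row]

/-- The formula that says that the variable `4` is the number of candidates. -/
def lead : Fm :=
  and (allBelow 7 4 (sym (.var 7) (· = some (Γ'.bit true)))) (endsAt (.var 4))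

theorem holds_lead (h : e 4 ≤ w.length) : lead.Holds (Γ'.blank :: w) m e ↔ Lead w (e 4) := by
  simp [lead, Lead, holds_allBelow, h, Term.value]

/-- The formula that says that every comma is followed by a weak order. -/
def valid : Fm :=
  all 5 (imp (comma 5)
    (and (allBelow 7 4 (allBelow 8 4 (sym (entryTerm 7 8) fun o =>
        decide (o = some (Γ'.bit true) ∨ o = some (Γ'.bit false)))))
      (and (endsAt (.add (.add (.var 5) .one) (.mul (.var 4) (.var 4))))
        (and (allBelow 7 4 (allBelow 8 4 (or (row 7 8) (row 8 7))))
          (allBelow 7 4 (allBelow 8 4 (allBelow 9 4 (imp (row 7 8) (imp (row 8 9) (row 7 9))))))))))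

theorem holds_valid (h : e 4 ≤ w.length) : valid.Holds (Γ'.blank :: w) m e ↔ Valid w (e 4) := by
  have hb : ∀ p : ℕ, (∃ β, w[p]? = some (Γ'.bit β)) ↔
      w[p]? = some (Γ'.bit true) ∨ w[p]? = some (Γ'.bit false) := fun p => by
    rw [Bool.exists_bool, Or.comm]
  have hp : ∀ p : ℕ, w[p]? = some Γ'.comma → p < w.length + 1 := fun p hp => by
    have := (List.getElem?_eq_some_iff.1 hp).1
    omega
  simp only [valid, Valid, hb, holds_all, holds_imp, holds_and, holds_comma,
    holds_endsAt, List.length_cons]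
  refine forall_congr' fun p => ?_
  -- A comma at `p` implies the bound of the quantifier on `p`, so the bound can be discharged once
  -- the comma is assumed.
  rw [forall_comm]
  refine forall_congr' fun hp' => ?_
  simp [holds_allBelow, h, Term.value, hp p (by simpa using hp')]

/-- The formula that says that `d` is forced not to lie between `e` and `c`. -/
def forces (e d c : Fin 12) : Fm :=
  ex 4 (and lead (ex 5 (and (lt e 4) (and (lt d 4) (and (lt c 4) (and (neg (eq e d))
    (and (neg (eq c d)) (and (comma 5) (and (row e d) (and (row c d)
      (neg (allBelow 10 4 (row d 10)))))))))))))

end Fm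

theorem Lead.le {w : List Γ'} {m : ℕ} (h : Lead w m) : m ≤ w.length := by
  by_contra hlt
  have := h.1 w.length (by omega)
  simp at this

namespace Fm

variable {w m : List Γ'} {e : Fin 12 → ℕ}

/-- The indices must avoid the variables bound around them: `4` and `5` for all three, and `10` only
for `j`, which alone occurs in the test for not being top. -/
theorem holds_forces {i j k : Fin 12} (hi : i ≠ 4 ∧ i ≠ 5) (hj : j ≠ 4 ∧ j ≠ 5 ∧ j ≠ 10)
    (hk : k ≠ 4 ∧ k ≠ 5) :
    (forces i j k).Holds (Γ'.blank :: w) m e ↔ WordForces w (e i) (e j) (e k) := by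
  simp only [forces, holds_ex, holds_and, List.length_cons, Nat.lt_succ_iff]
  constructor
  · rintro ⟨n, hn, hl, p, hp, h1, h2, h3, h4, h5, h6, h7, h8, h9⟩
    rw [holds_lead (by simpa using hn)] at hl
    rw [holds_neg, holds_allBelow (by decide) _ (by simpa using hn)] at h9
    simp [hi, hj, hk] at hl h1 h2 h3 h4 h5 h6 h7 h8 h9
    exact ⟨n, p, hl, h1, h2, h3, h4, h5, h6, h7, h8, h9⟩
  · rintro ⟨n, p, hl, h1, h2, h3, h4, h5, h6, h7, h8, h9⟩
    have hp := (List.getElem?_eq_some_iff.1 h6).1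
    refine ⟨n, hl.le, (holds_lead (by simpa using hl.le)).2 (by simpa using hl), p, hp.le, ?_⟩
    simp only [holds_lt, holds_neg, holds_eq, holds_comma, holds_row]
    rw [holds_allBelow (by decide) _ (by simpa using hl.le)]
    simp [hi, hj, hk]
    exact ⟨h1, h2, h3, h4, h5, h6, h7, h8, h9⟩

end Fm

/-! ### Reachability by marking memory cells. -/

/-- The number of the memory cell for a quadruple of numbers below `n`. -/
def cell (n a b c d : ℕ) : ℕ := ((a * n + b) * n + c) * n + d

theorem mul_add_inj {n a b a' b' : ℕ} (hb : b < n) (hb' : b' < n) (h : a * n + b = a' * n + b') :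
    a = a' ∧ b = b' := by
  have h1 : (a * n + b) % n = b := by
    rw [Nat.add_comm, Nat.add_mul_mod_self_right, Nat.mod_eq_of_lt hb]
  have h2 : (a' * n + b') % n = b' := by
    rw [Nat.add_comm, Nat.add_mul_mod_self_right, Nat.mod_eq_of_lt hb']
  have hbb : b = b' := by rw [← h1, h, h2]
  subst hbb
  exact ⟨Nat.eq_of_mul_eq_mul_right (by omega) (Nat.add_right_cancel h), rfl⟩

/-- The quadruple consists of the digits in base `n`; the leading digit needs no bound. -/
theorem cell_inj {n a b c d a' b' c' d' : ℕ} (hb : b < n) (hc : c < n) (hd : d < n) (hb' : b' < n)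
    (hc' : c' < n) (hd' : d' < n) (h : cell n a b c d = cell n a' b' c' d') :
    a = a' ∧ b = b' ∧ c = c' ∧ d = d' := by
  obtain ⟨h1, rfl⟩ := mul_add_inj hd hd' h
  obtain ⟨h2, rfl⟩ := mul_add_inj hc hc' h1
  obtain ⟨rfl, rfl⟩ := mul_add_inj hb hb' h2
  exact ⟨rfl, rfl, rfl, rfl⟩

theorem cell_lt {n a b c d : ℕ} (ha : a < n) (hb : b < n) (hc : c < n) (hd : d < n) :
    cell n a b c d < n ^ 4 := by
  have step : ∀ x y k, x < k → y < n → x * n + y < k * n := fun x y k hx hy => by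
    have := Nat.mul_le_mul_right n (show x + 1 ≤ k from hx)
    rw [add_mul] at this
    omega
  have := step _ d _ (step _ c _ (step a b n ha hb) hc) hd
  calc cell n a b c d < n * n * n * n := this
    _ = n ^ 4 := by ring

/-- The term for the number of a memory cell. -/
def cellTerm (a b c d : Fin 12) : Term :=
  .add (.mul (.add (.mul (.add (.mul (.var a) .len) (.var b)) .len) (.var c)) .len) (.var d)

@[simp] theorem value_cellTerm (w : List Γ') (e : Fin 12 → ℕ) (a b c d : Fin 12) :
    (cellTerm a b c d).value w e = cell w.length (e a) (e b) (e c) (e d) := rfl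

/-- The condition under which the pair `(2, 3)` is found to be reachable from `(0, 1)`. -/
def reachStep : Fm :=
  .or (.and (.eq 0 2) (.eq 1 3))
    (.ex 6 (.or (.and (.mem (cellTerm 0 1 6 3)) (.forces 6 3 2))
      (.and (.mem (cellTerm 0 1 2 6)) (.forces 6 2 3))))

/-- One round of the computation of the reachable pairs. -/
def reachRound : Prog :=
  .each 0 (.each 1 (.each 2 (.each 3 (.cond reachStep (.set (cellTerm 0 1 2 3))))))

/-- The computation of the reachable pairs. -/
def reachProg : Prog := .times (.mul (.mul (.mul .len .len) .len) .len) reachRound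

/-- The formula that says that the word is the code of a single-plateaued profile. -/
def plateauFm : Fm :=
  .ex 4 (.and .lead (.and .valid (.allBelow 0 4 (.allBelow 1 4 (.imp (.neg (.eq 0 1))
    (.neg (.mem (cellTerm 0 1 1 0))))))))

/-- The environment with given values of the first four variables. -/
def quad (a b c d : ℕ) : Fin 12 → ℕ :=
  update (update (update (update (fun _ => 0) 0 a) 1 b) 2 c) 3 d

theorem holds_reachStep {w M : List Γ'} {a b c d : ℕ} :
    reachStep.Holds (Γ'.blank :: w) M (quad a b c d) ↔ (a = c ∧ b = d) ∨ ∃ e < w.length + 1,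
      (M[cell (w.length + 1) a b e d]? = some (Γ'.bit true) ∧ WordForces w e d c) ∨
      (M[cell (w.length + 1) a b c e]? = some (Γ'.bit true) ∧ WordForces w e c d) := by
  simp [reachStep, Fm.holds_forces, quad]

/-- The conclusion is an invariant `I` of the memory: it holds vacuously for blanks, and a newly
marked cell either stands for the empty path or extends a recorded path by one link. This works for
any size of the memory. -/
theorem reachProg_sound (w : List Γ') (n : ℕ) :
    ∀ a < w.length + 1, ∀ b < w.length + 1, ∀ c < w.length + 1, ∀ d < w.length + 1,
      (reachProg.run (Γ'.blank :: w) (fun _ => 0) (List.replicate n Γ'.blank))[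
        cell (w.length + 1) a b c d]? = some (Γ'.bit true) →
      Relation.ReflTransGen (WordLink w) (a, b) (c, d) := by
  let I : List Γ' → Prop := fun M =>
    ∀ a < w.length + 1, ∀ b < w.length + 1, ∀ c < w.length + 1, ∀ d < w.length + 1,
      M[cell (w.length + 1) a b c d]? = some (Γ'.bit true) →
      Relation.ReflTransGen (WordLink w) (a, b) (c, d)
  change I _
  refine Prog.run_times_induction I (fun M hM => ?_) _ fun a _ b _ c _ d _ h => ?_
  · refine Prog.run_each_induction I (fun a ha M hM => ?_) _ hM
    refine Prog.run_each_induction I (fun b hb M hM => ?_) _ hM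
    refine Prog.run_each_induction I (fun c hc M hM => ?_) _ hM
    refine Prog.run_each_induction I (fun d hd M hM => ?_) _ hM
    change I (Prog.run _ _ (quad a b c d) M)
    rw [Prog.run]
    split_ifs with hstep
    · intro a' ha' b' hb' c' hc' d' hd' h
      have hval : (cellTerm 0 1 2 3).value (Γ'.blank :: w) (quad a b c d) =
          cell (w.length + 1) a b c d := by simp [quad]
      rw [Prog.run, hval, List.getElem?_set] at h
      split_ifs at h with h1 h2
      -- Distinct quadruples have distinct cells, so the mark just set speaks about no other
      -- quadruple.
      · obtain ⟨rfl, rfl, rfl, rfl⟩ := cell_inj hb hc hd hb' hc' hd' h1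
        rw [holds_reachStep] at hstep
        rcases hstep with ⟨rfl, rfl⟩ | ⟨e, he, ⟨h3, h4⟩ | ⟨h3, h4⟩⟩
        · exact .refl
        · exact (hM a ha b hb e he d hd h3).tail (.left h4)
        · exact (hM a ha b hb c hc e he h3).tail (.right h4)
      · exact hM a' ha' b' hb' c' hc' d' hd' h
    · exact hM
  · rw [List.getElem?_replicate] at h
    split_ifs at h
    simp at h

/-- There are as many rounds as cells, so the final memory is fixed by a further round. It is then
closed under `reachStep`, and induction along a path marks all its pairs. -/
theorem reachProg_complete (w : List Γ') {a b c d : ℕ} (ha : a < w.length + 1)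
    (hb : b < w.length + 1) (h : Relation.ReflTransGen (WordLink w) (a, b) (c, d)) :
    (reachProg.run (Γ'.blank :: w) (fun _ => 0)
      (List.replicate ((w.length + 1) ^ 4) Γ'.blank))[cell (w.length + 1) a b c d]? =
        some (Γ'.bit true) := by
  set M := reachProg.run (Γ'.blank :: w) (fun _ => 0)
    (List.replicate ((w.length + 1) ^ 4) Γ'.blank) with hM
  have hlen : M.length = (w.length + 1) ^ 4 := by rw [hM, Prog.length_run, List.length_replicate]
  have hfix : reachRound.run (Γ'.blank :: w) (fun _ => 0) M = M :=
    Prog.run_run_times (by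
      simp only [List.length_replicate, Term.value, List.length_cons]
      exact (by ring : (w.length + 1) ^ 4 = _).le)
  have hclosed : ∀ c < w.length + 1, ∀ d < w.length + 1,
      reachStep.Holds (Γ'.blank :: w) M (quad a b c d) →
      M[cell (w.length + 1) a b c d]? = some (Γ'.bit true) := by
    intro c hc d hd hstep
    -- If a whole round changes nothing, neither does its innermost command for any quadruple; a
    -- cell whose condition holds must be marked already.
    have h1 := Prog.run_eq_of_each (Prog.run_eq_of_each (Prog.run_eq_of_each
      (Prog.run_eq_of_each hfix (k := a) ha) (k := b) hb) (k := c) hc) (k := d) hd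
    change Prog.run _ _ (quad a b c d) M = M at h1
    rw [Prog.run, if_pos hstep, Prog.run] at h1
    have hval : (cellTerm 0 1 2 3).value (Γ'.blank :: w) (quad a b c d) =
        cell (w.length + 1) a b c d := by simp [quad]
    rw [hval] at h1
    rw [← h1, List.getElem?_set_self (by rw [hlen]; exact cell_lt ha hb hc hd)]
  have key : ∀ y, Relation.ReflTransGen (WordLink w) (a, b) y → y.1 < w.length + 1 ∧
      y.2 < w.length + 1 ∧ M[cell (w.length + 1) a b y.1 y.2]? = some (Γ'.bit true) := by
    intro y hy
    induction hy with
    | refl => exact ⟨ha, hb, hclosed a ha b hb (holds_reachStep.2 (.inl ⟨rfl, rfl⟩))⟩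
    | tail _ hl ih =>
      obtain ⟨h1, h2, h3⟩ := ih
      cases hl with
      | @left e d c hf =>
        have hf' := hf
        obtain ⟨m, p, lead, -, -, hc, -⟩ := hf'
        have hc' : c < w.length + 1 := by have := lead.le; omega
        exact ⟨hc', h2, hclosed c hc' d h2 (holds_reachStep.2 (.inr ⟨e, h1, .inl ⟨h3, hf⟩⟩))⟩
      | @right e d c hf =>
        have hf' := hf
        obtain ⟨m, p, lead, -, -, hc, -⟩ := hf'
        have hc' : c < w.length + 1 := by have := lead.le; omega
        exact ⟨h1, hc', hclosed d h1 c hc' (holds_reachStep.2 (.inr ⟨e, h2, .inr ⟨h3, hf⟩⟩))⟩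
  exact (key _ h).2.2

theorem mem_singlePlateauedLanguage_iff_holds (w : List Γ') : w ∈ singlePlateauedLanguage ↔
    plateauFm.Holds (Γ'.blank :: w) (reachProg.run (Γ'.blank :: w) (fun _ => 0)
      (List.replicate ((w.length + 1) ^ 4) Γ'.blank)) (fun _ => 0) := by
  rw [mem_singlePlateauedLanguage_iff]
  set M := reachProg.run (Γ'.blank :: w) (fun _ => 0)
    (List.replicate ((w.length + 1) ^ 4) Γ'.blank) with hM
  have hreach : ∀ a < w.length + 1, ∀ b < w.length + 1,
      Relation.ReflTransGen (WordLink w) (a, b) (b, a) ↔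
        M[cell (w.length + 1) a b b a]? = some (Γ'.bit true) := fun a ha b hb =>
    ⟨fun h => reachProg_complete w ha hb h, fun h => reachProg_sound w _ a ha b hb b hb a ha h⟩
  have hfm : ∀ n, n < w.length + 1 → ((Fm.and .lead (Fm.and .valid (.allBelow 0 4
      (.allBelow 1 4 (.imp (.neg (.eq 0 1)) (.neg (.mem (cellTerm 0 1 1 0)))))))).Holds
      (Γ'.blank :: w) M (update (fun _ => 0) 4 n) ↔
      Lead w n ∧ Valid w n ∧ ∀ a < n, ∀ b < n, a ≠ b →
        ¬ Relation.ReflTransGen (WordLink w) (a, b) (b, a)) := by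
    intro n hn
    have hn' : n ≤ w.length := by omega
    rw [Fm.holds_and, Fm.holds_and, Fm.holds_lead (by simpa using hn'),
      Fm.holds_valid (by simpa using hn'), Fm.holds_allBelow (by decide) _ (by simpa using hn'),
      update_self]
    refine and_congr_right fun _ => and_congr_right fun _ => forall₂_congr fun a ha => ?_
    rw [Fm.holds_allBelow (by decide) _ (by simpa using hn')]
    simp only [Fin.isValue, ne_eq, Fin.reduceEq, not_false_eq_true, update_of_ne, update_self]
    refine forall₂_congr fun b hb => ?_
    rw [hreach a (by omega) b (by omega)]
    simp
  rw [plateauFm, Fm.holds_ex]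
  constructor
  · rintro ⟨n, hl, h⟩
    -- The number of candidates may equal `w.length`, namely when there are no votes; thanks to the
    -- leading blank the quantifier still reaches it.
    have hn : n < w.length + 1 := by have := hl.le; omega
    exact ⟨n, by simpa using hn, (hfm n hn).2 ⟨hl, h⟩⟩
  · rintro ⟨n, hn, h⟩
    exact ⟨n, (hfm n (by simpa using hn)).1 h⟩

end SinglePlateaued

theorem theorem4 : SinglePlateaued.InP SinglePlateaued.singlePlateauedLanguage :=
  SinglePlateaued.inP_of_prog SinglePlateaued.reachProg SinglePlateaued.plateauFm
    SinglePlateaued.mem_singlePlateauedLanguage_iff_holds
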